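/- Let $\mathbb K=\mathbb R$ or $\mathbb C$; "smooth" means $C^\infty$ over $\mathbb K$ (holomorphic if $\mathbb K=\mathbb C$). Let $\mathcal G=(\mathfrak g,[\,,],\varpi,\varphi)$ be a finite-dimensional Lie quasi-bialgebra over $\mathbb K$: $\mathfrak g$ is a Lie algebra, $\varpi$ is a Lie algebra $1$-cocycle on $\mathfrak g$ with values in the skew-symmetric linear maps $\mathfrak g^*\to\mathfrak g$, $\varphi\in\wedge^3\mathfrak g$, and the double $\mathfrak d=\mathfrak g\oplus\mathfrak g^*$ is a Lie algebra for the bracket extending that of $\mathfrak g$ with $[x,\xi]=\varpi_x\xi-\mathrm{ad}_x^*\xi$ and $[\xi,\eta]=\langle\eta,\varpi_\bullet\xi\rangle+\langle\xi\otimes\eta\otimes1,\varphi\rangle$, where $\langle\mathrm{ad}^*_x\xi,y\rangle=\langle\xi,[x,y]\rangle$. Let $\mathfrak g=\mathfrak l\oplus\mathfrak m$ be a reductive decomposition ($\mathfrak l$ is a subalgebra and $[\mathfrak l,\mathfrak m]\subset\mathfrak m$), with inclusion $i:\mathfrak l\to\mathfrak g$, projection $p_{\mathfrak l}:\mathfrak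 g\to\mathfrak l$ along $\mathfrak m$ and $s=(p_{\mathfrak l})^*:\mathfrak l^*\to\mathfrak g^*$. Assume that $\mathcal G$ is canonically compatible with it: $\varpi_{\mathfrak l}=0$, $\langle\mathfrak m^\perp,\varpi_\bullet\mathfrak m^\perp\rangle=0$, $\varphi\in\mathrm{Alt}(\mathfrak l\otimes\mathfrak l\otimes\mathfrak l\oplus\mathfrak l\otimes\mathfrak m\otimes\mathfrak m\oplus\mathfrak m\otimes\mathfrak m\otimes\mathfrak m)$ and $\varphi\equiv0$ mod $\mathfrak l$. Give $\mathfrak l\oplus\mathfrak l^*$ the bracket of the double of $(\mathfrak l,[\,,],0,p_{\mathfrak l}^{(3)}\varphi)$. Let $U\subset\mathfrak l^*$ be the open set of all $p$ such that the spectrum of $\mathrm{ad}_p$ on $\mathfrak l\oplus\mathfrak l^*$ contains no nonzero integer multiple of $i\pi$ and $p_{\mathfrak g}\mathrm{Ad}_{e^{-sp}}i_{\mathfrak g}$ is invertible, where $\mathrm{Ad}_{e^X}=e^{\mathrm{ad}_X}$ on $\mathfrak d$, and $i_{\mathfrak g}$, $p_{\mathfrak g}$ are the inclusion of $\mathfrak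 g$ in $\mathfrak d$ and the projection along $\mathfrak g^*$. Let $l:U\to\mathcal L(\mathfrak g^*,\mathfrak g)$ be the canonical $\ell$-matrix, the smooth map $$l_p(s\alpha+\xi)=F(\mathrm{ad}_p^{\mathfrak l\oplus\mathfrak l^*})\alpha-(p_{\mathfrak g}\mathrm{Ad}_{e^{-sp}}i_{\mathfrak g})^{-1}p_{\mathfrak g}\mathrm{Ad}_{e^{-sp}}\xi\qquad(\alpha\in\mathfrak l^*,\ \xi\in\mathfrak l^\perp),\qquad F(x)=\coth x-\tfrac1x .$$ Let $N(U)=U\times\mathfrak l\times\mathfrak g^*$, with anchor $a_p(z,\xi)=i^*\xi-\mathrm{ad}_z^*p$ and the bracket of sections $$\begin{aligned}[(z,\xi),(z',\xi')]_p=\big(&\mathrm d_pz'(a_p(z_p,\xi_p))-\mathrm d_pz(a_p(z'_p,\xi'_p))-[z_p,z'_p]+\langle\xi_p,\mathrm d_pl(\cdot)\xi'_p\rangle,\\&\mathrm d_p\xi'(a_p(z_p,\xi_p))-\mathrm d_p\xi(a_p(z'_p,\xi'_p))+\mathrm{ad}^*_{z_p}\xi'_p-\mathrm{ad}^*_{z'_p}\xi_p+\langle\xi_p,\varpi_\bullet\xi'_p\rangle+\mathrm{ad}^*_{l_p\xi_p}\xi'_p-\mathrm{ad}^*_{l_p\xi'_p}\xi_p\big).\end{aligned}$$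 For $p\in U$ let $\mathfrak g^\star_p=\{z+\xi\in\mathfrak l\oplus\mathfrak g^*: i^*\xi=\mathrm{ad}^*_zp\}=\ker a_p$, let $\phi_p(x+\xi)=\mathrm{Ad}_{e^{-sp}}(x+l_p\xi+\xi)$ on $\mathfrak d$, and let $\psi(p,X)=(p,-\phi_p^{-1}X)$ for $X\in\mathfrak g^\star_0=\mathfrak l\oplus\mathfrak l^\perp$. Then $U$ is open, $l$ is smooth on $U$, and: (1) The bundle map $$\theta:U\times\mathfrak l^*\to N(U),\qquad\theta(p,\alpha)=\Big(p,\ \frac{\sinh\mathrm{ad}_{sp}-\mathrm{ad}_{sp}}{\mathrm{ad}_{sp}^2}s\alpha,\ \frac{\sinh\mathrm{ad}_{sp}}{\mathrm{ad}_{sp}}s\alpha\Big)$$ is well defined (the second entry lies in $\mathfrak l$, the third in $\mathfrak g^*$) and is a flat connection on $N(U)$: it is smooth, $a_p(\theta(p,\alpha))=\alpha$, and $[\theta\alpha,\theta\beta]=\theta[\alpha,\beta]$ for all smooth vector fields $\alpha,\beta:U\to\mathfrak l^*$. (2) For each $p\in U$, $\phi_p$ is invertible and maps $\mathfrak g^\star_p$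 bijectively onto $\mathfrak g^\star_0$, so that $\psi$ is a well-defined bundle isomorphism $U\times\mathfrak g_0^\star\to\ker a$. For all smooth $\alpha:U\to\mathfrak l^*$ and $X:U\to\mathfrak g_0^\star$, the section $\psi X$ is smooth and $$[\theta\alpha,\psi X]=\psi(\mathrm dX(\alpha)).$$ -/

import Mathlib

open scoped ContDiff

noncomputable section

/-! ### Linear algebra and operator functions

All vector spaces are finite dimensional over `𝕜 = ℝ` or `ℂ`. They carry an (arbitrary) norm, which
is used only for the topology, i.e. to speak of smooth maps, differentials and convergent series.
The dual of `E` is `StrongDual 𝕜 E`. -/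

/-- The inclusion of `𝕜 = ℝ` or `ℂ` in `ℂ`. -/
def toComplexHom (𝕜 : Type*) [RCLike 𝕜] : 𝕜 →+* ℂ where
  toFun x := ⟨RCLike.re x, RCLike.im x⟩
  map_one' := by apply Complex.ext <;> simp
  map_zero' := by apply Complex.ext <;> simp
  map_add' x y := by apply Complex.ext <;> simp
  map_mul' x y := by apply Complex.ext <;> simp

/-- The complex spectrum of an endomorphism of a finite-dimensional real or complex vector space:
the set of complex roots of its characteristic polynomial. -/
def complexSpectrum {𝕜 : Type*} [RCLike 𝕜] {E : Type*} [NormedAddCommGroup E] [NormedSpace 𝕜 E]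
    [FiniteDimensional 𝕜 E] (f : E →L[𝕜] E) : Set ℂ :=
  {lam | ((f : E →ₗ[𝕜] E).charpoly.map (toComplexHom 𝕜)).IsRoot lam}

/-- The vector `v` with `α v = Φ α` for all `α`, for an element `Φ` of the bidual of a
finite-dimensional space. -/
def ofBidual {𝕜 : Type*} [RCLike 𝕜] {E : Type*} [NormedAddCommGroup E] [NormedSpace 𝕜 E]
    [FiniteDimensional 𝕜 E] (Φ : StrongDual 𝕜 (StrongDual 𝕜 E)) : E :=
  (Module.evalEquiv 𝕜 E).symm
    ((Φ : StrongDual 𝕜 E →ₗ[𝕜] 𝕜) ∘ₗ (LinearMap.toContinuousLinearMap : _ ≃ₗ[𝕜] (E →L[𝕜] 𝕜)))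

theorem apply_ofBidual {𝕜 : Type*} [RCLike 𝕜] {E : Type*} [NormedAddCommGroup E]
    [NormedSpace 𝕜 E] [FiniteDimensional 𝕜 E] (Φ : StrongDual 𝕜 (StrongDual 𝕜 E))
    (α : StrongDual 𝕜 E) : α (ofBidual Φ) = Φ α := by
  have h := Module.apply_evalEquiv_symm_apply (R := 𝕜) (M := E) (α : E →ₗ[𝕜] 𝕜)
    ((Φ : StrongDual 𝕜 E →ₗ[𝕜] 𝕜) ∘ₗ (LinearMap.toContinuousLinearMap : _ ≃ₗ[𝕜] (E →L[𝕜] 𝕜)))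
  exact h

section OperatorFunctions

variable {𝕜 : Type*} [RCLike 𝕜] {E : Type*} [NormedAddCommGroup E] [NormedSpace 𝕜 E]

/-- The exponential `e^A`. -/
def opExp (A : E →L[𝕜] E) : E →L[𝕜] E := NormedSpace.exp A

/-- `sinh A / A`, from the entire function `sinh z / z = ∑ z ^ (2 n) / (2 n + 1)!`. -/
def sinhDiv (A : E →L[𝕜] E) : E →L[𝕜] E :=
  ∑' n : ℕ, ((2 * n + 1).factorial : 𝕜)⁻¹ • A ^ (2 * n)

/-- `(sinh A - A) / A ^ 2`, from the entire function
`(sinh z - z) / z ^ 2 = ∑ z ^ (2 n + 1) / (2 n + 3)!`. -/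
def sinhSubDivSq (A : E →L[𝕜] E) : E →L[𝕜] E :=
  ∑' n : ℕ, ((2 * n + 3).factorial : 𝕜)⁻¹ • A ^ (2 * n + 1)

/-- `(cosh A - sinh A / A) / A`, from the entire function
`(cosh z - sinh z / z) / z = ∑ (1 / (2 n + 2)! - 1 / (2 n + 3)!) z ^ (2 n + 1)`. -/
def coshSubSinhDivDiv (A : E →L[𝕜] E) : E →L[𝕜] E :=
  ∑' n : ℕ, (((2 * n + 2).factorial : 𝕜)⁻¹ - ((2 * n + 3).factorial : 𝕜)⁻¹) • A ^ (2 * n + 1)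

/-- `F(A)` for the meromorphic function `F(z) = coth z - 1 / z`, with poles at the nonzero integer
multiples of `i π`, and an endomorphism `A` whose complex spectrum contains none of these. As
`F(z) = ((cosh z - sinh z / z) / z) / (sinh z / z)` is a quotient of entire functions, `F(A)` is the
corresponding quotient of operators; on such `A`, the operator `sinh A / A` is invertible. -/
def cothSubInv (A : E →L[𝕜] E) : E →L[𝕜] E :=
  coshSubSinhDivDiv A * Ring.inverse (sinhDiv A)

end OperatorFunctions

/-! ### Lie quasi-bialgebras -/

/-- The data `(𝔤, [,], ϖ, φ)` of a Lie quasi-bialgebra, without its laws. An element `φ` of `𝔤^{⊗3}`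
is given as the bilinear map `assoc : 𝔤* × 𝔤* → 𝔤`, `(ξ, η) ↦ ⟨ξ ⊗ η ⊗ 1, φ⟩`, so that
`⟨ξ ⊗ η ⊗ ζ, φ⟩ = ζ (assoc ξ η)`. -/
structure LQBData (𝕜 : Type*) [RCLike 𝕜] (V : Type*) [NormedAddCommGroup V] [NormedSpace 𝕜 V] where
  bracket : V →L[𝕜] V →L[𝕜] V
  cocycle : V →L[𝕜] StrongDual 𝕜 V →L[𝕜] V
  assoc : StrongDual 𝕜 V →L[𝕜] StrongDual 𝕜 V →L[𝕜] V

namespace LQBData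

variable {𝕜 : Type*} [RCLike 𝕜] {V : Type*} [NormedAddCommGroup V] [NormedSpace 𝕜 V]

/-- `ad*_x ξ`, the adjoint of `ad_x`: `⟨ad*_x ξ, y⟩ = ⟨ξ, [x, y]⟩`. -/
def adStar (G : LQBData 𝕜 V) (x : V) (ξ : StrongDual 𝕜 V) : StrongDual 𝕜 V :=
  ξ.comp (G.bracket x)

/-- `⟨ξ, ϖ_• η⟩ ∈ 𝔤*`, the linear form `x ↦ ⟨ξ, ϖ_x η⟩`. -/
def cocycleForm (G : LQBData 𝕜 V) (ξ η : StrongDual 𝕜 V) : StrongDual 𝕜 V :=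
  ξ.comp (G.cocycle.flip η)

/-- The bracket of the double `𝔡 = 𝔤 ⊕ 𝔤*`:
`[x, y]_𝔡 = [x, y]`, `[x, ξ]_𝔡 = ϖ_x ξ - ad*_x ξ`, `[ξ, η]_𝔡 = ⟨η, ϖ_• ξ⟩ + ⟨ξ ⊗ η ⊗ 1, φ⟩`. -/
def doubleBracket (G : LQBData 𝕜 V) (X Y : V × StrongDual 𝕜 V) : V × StrongDual 𝕜 V :=
  (G.bracket X.1 Y.1 + G.cocycle X.1 Y.2 - G.cocycle Y.1 X.2 + G.assoc X.2 Y.2,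
    G.adStar Y.1 X.2 - G.adStar X.1 Y.2 + G.cocycleForm Y.2 X.2)

/-- `(𝔤, [,], ϖ, φ)` is a Lie quasi-bialgebra: `[,]` is a Lie bracket, `ϖ` is a Lie algebra
`1`-cocycle with values in the skew-symmetric maps `𝔤* → 𝔤`, `φ` is in `∧³ 𝔤`, and the double is a
Lie algebra. -/
structure IsLieQuasiBialgebra (G : LQBData 𝕜 V) : Prop where
  bracket_self : ∀ x, G.bracket x x = 0
  jacobi : ∀ x y z, G.bracket x (G.bracket y z) =
    G.bracket (G.bracket x y) z + G.bracket y (G.bracket x z)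
  cocycle_skew : ∀ (x : V) (ξ η : StrongDual 𝕜 V), ξ (G.cocycle x η) = -η (G.cocycle x ξ)
  cocycle_bracket : ∀ x y ξ, G.cocycle (G.bracket x y) ξ =
    G.bracket x (G.cocycle y ξ) + G.cocycle y (G.adStar x ξ)
      - G.bracket y (G.cocycle x ξ) - G.cocycle x (G.adStar y ξ)
  assoc_skew_left : ∀ ξ η ζ : StrongDual 𝕜 V, ζ (G.assoc ξ η) = -ζ (G.assoc η ξ)
  assoc_skew_right : ∀ ξ η ζ : StrongDual 𝕜 V, ζ (G.assoc ξ η) = -η (G.assoc ξ ζ)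
  double_self : ∀ X, G.doubleBracket X X = 0
  double_jacobi : ∀ X Y Z, G.doubleBracket X (G.doubleBracket Y Z) =
    G.doubleBracket (G.doubleBracket X Y) Z + G.doubleBracket Y (G.doubleBracket X Z)

/-- `ad_X` as an endomorphism of the double. -/
def adDouble [FiniteDimensional 𝕜 V] (G : LQBData 𝕜 V) (X : V × StrongDual 𝕜 V) :
    (V × StrongDual 𝕜 V) →L[𝕜] (V × StrongDual 𝕜 V) :=
  LinearMap.toContinuousLinearMap
    { toFun := fun Y => G.doubleBracket X Y
      map_add' := fun Y Z => by
        ext <;> simp [doubleBracket, adStar, cocycleForm] <;> abel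
      map_smul' := fun c Y => by
        ext <;> simp [doubleBracket, adStar, cocycleForm, smul_add, smul_sub] }

/-- `Ad_{e^X} = e^{ad_X}` on the double. -/
def AdExp [FiniteDimensional 𝕜 V] (G : LQBData 𝕜 V) (X : V × StrongDual 𝕜 V) :
    (V × StrongDual 𝕜 V) →L[𝕜] (V × StrongDual 𝕜 V) :=
  opExp (G.adDouble X)

end LQBData

/-- The map `τ_t : x + ξ ↦ x + t ξ + ξ` of `𝔤 ⊕ 𝔤*`, for `t : 𝔤* → 𝔤`. -/
def twistMap {𝕜 : Type*} [RCLike 𝕜] {V : Type*} [NormedAddCommGroup V] [NormedSpace 𝕜 V]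
    (t : StrongDual 𝕜 V →L[𝕜] V) : (V × StrongDual 𝕜 V) →L[𝕜] (V × StrongDual 𝕜 V) :=
  (ContinuousLinearMap.fst 𝕜 V (StrongDual 𝕜 V)
    + t.comp (ContinuousLinearMap.snd 𝕜 V (StrongDual 𝕜 V))).prod
    (ContinuousLinearMap.snd 𝕜 V (StrongDual 𝕜 V))

/-! ### Reductive decompositions and the canonical `ℓ`-matrix -/

/-- A reductive decomposition `𝔤 = 𝔩 ⊕ 𝔪`: `𝔩` is a subalgebra and `[𝔩, 𝔪] ⊆ 𝔪`. -/
structure ReductiveDecomposition {𝕜 : Type*} [RCLike 𝕜] {V : Type*} [NormedAddCommGroup V]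
    [NormedSpace 𝕜 V] (G : LQBData 𝕜 V) where
  l : Submodule 𝕜 V
  m : Submodule 𝕜 V
  isCompl : IsCompl l m
  bracket_l_l : ∀ x ∈ l, ∀ y ∈ l, G.bracket x y ∈ l
  bracket_l_m : ∀ x ∈ l, ∀ y ∈ m, G.bracket x y ∈ m

namespace ReductiveDecomposition

variable {𝕜 : Type*} [RCLike 𝕜] {V : Type*} [NormedAddCommGroup V] [NormedSpace 𝕜 V]
  [FiniteDimensional 𝕜 V] {G : LQBData 𝕜 V}

/-- The projection `p_𝔩 : 𝔤 → 𝔩` along `𝔪`. -/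
def projL (D : ReductiveDecomposition G) : V →L[𝕜] D.l :=
  LinearMap.toContinuousLinearMap (D.l.projectionOnto D.m D.isCompl)

/-- The restriction `i* : 𝔤* → 𝔩*`. -/
def restr (D : ReductiveDecomposition G) : StrongDual 𝕜 V →L[𝕜] StrongDual 𝕜 D.l :=
  (ContinuousLinearMap.compL 𝕜 D.l V 𝕜).flip D.l.subtypeL

/-- `s = (p_𝔩)* : 𝔩* → 𝔤*`. -/
def s (D : ReductiveDecomposition G) : StrongDual 𝕜 D.l →L[𝕜] StrongDual 𝕜 V :=
  (ContinuousLinearMap.compL 𝕜 V D.l 𝕜).flip D.projL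

/-- `s`, seen as a map from `𝔩*` to the double of `G`. -/
def sDouble (D : ReductiveDecomposition G) : StrongDual 𝕜 D.l →L[𝕜] (V × StrongDual 𝕜 V) :=
  (ContinuousLinearMap.inr 𝕜 V (StrongDual 𝕜 V)).comp D.s

/-- The Lie quasi-bialgebra `G` is canonically compatible with `𝔤 = 𝔩 ⊕ 𝔪`: `ϖ` vanishes on `𝔩`,
`⟨𝔪^⊥, ϖ_• 𝔪^⊥⟩ = 0`, `φ ∈ Alt(𝔩⊗𝔩⊗𝔩 ⊕ 𝔩⊗𝔪⊗𝔪 ⊕ 𝔪⊗𝔪⊗𝔪)` (that is, `φ` has no component in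
`𝔩 ∧ 𝔩 ∧ 𝔪`), and `φ ≡ 0` modulo `𝔩` (that is, `φ` vanishes in `∧³ (𝔤/𝔩)`). -/
structure IsCanonicallyCompatible (D : ReductiveDecomposition G) : Prop where
  cocycle_l : ∀ x ∈ D.l, G.cocycle x = 0
  cocycle_m_perp : ∀ ξ η : StrongDual 𝕜 V, (∀ y ∈ D.m, ξ y = 0) → (∀ y ∈ D.m, η y = 0) →
    ∀ x, ξ (G.cocycle x η) = 0
  assoc_llm : ∀ ξ η ζ : StrongDual 𝕜 V, (∀ y ∈ D.m, ξ y = 0) → (∀ y ∈ D.m, η y = 0) →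
    (∀ z ∈ D.l, ζ z = 0) → ζ (G.assoc ξ η) = 0
  assoc_mod_l : ∀ ξ η ζ : StrongDual 𝕜 V, (∀ z ∈ D.l, ξ z = 0) → (∀ z ∈ D.l, η z = 0) →
    (∀ z ∈ D.l, ζ z = 0) → ζ (G.assoc ξ η) = 0

/-- The data `(𝔩, [,]_𝔩, 0, p_𝔩^{(3)} φ)`. -/
def subLQB (D : ReductiveDecomposition G) : LQBData 𝕜 D.l where
  bracket := (ContinuousLinearMap.compL 𝕜 D.l V D.l D.projL).comp
    (G.bracket.bilinearComp D.l.subtypeL D.l.subtypeL)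
  cocycle := 0
  assoc := (ContinuousLinearMap.compL 𝕜 (StrongDual 𝕜 D.l) V D.l D.projL).comp
    (G.assoc.bilinearComp D.s D.s)

theorem coe_subLQB_bracket (D : ReductiveDecomposition G) (x y : D.l) :
    ((D.subLQB.bracket x y : D.l) : V) = G.bracket x y := by
  have h : D.projL (G.bracket x y) = ⟨G.bracket x y, D.bracket_l_l _ x.2 _ y.2⟩ :=
    Submodule.projectionOnto_apply_left D.isCompl ⟨_, D.bracket_l_l _ x.2 _ y.2⟩
  exact congrArg Subtype.val h

/-- The endomorphism `p_𝔤 Ad_{e^{-sp}} i_𝔤` of `𝔤`. -/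
def adBlock (D : ReductiveDecomposition G) (p : StrongDual 𝕜 D.l) : V →L[𝕜] V :=
  (ContinuousLinearMap.fst 𝕜 V (StrongDual 𝕜 V)).comp
    ((G.AdExp (-D.sDouble p)).comp (ContinuousLinearMap.inl 𝕜 V (StrongDual 𝕜 V)))

/-- The set `U ⊆ 𝔩*` of all `p` such that the spectrum of `ad_p` on the double `𝔩 ⊕ 𝔩*` contains no
nonzero integer multiple of `i π`, and `0` is not in the spectrum of `p_𝔤 Ad_{e^{-sp}} i_𝔤`. -/
def U (D : ReductiveDecomposition G) : Set (StrongDual 𝕜 D.l) :=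
  {p | (∀ k : ℤ, k ≠ 0 →
      Complex.I * Real.pi * k ∉ complexSpectrum (D.subLQB.adDouble (0, p))) ∧
    (0 : ℂ) ∉ complexSpectrum (D.adBlock p)}

/-- The Alekseev--Meinrenken `r`-matrix of `(𝔩, [,]_𝔩, 0, p_𝔩^{(3)} φ)`:
`p ↦ F(ad_p) : 𝔩* → 𝔩` with `F(z) = coth z - 1 / z`. -/
def rAM (D : ReductiveDecomposition G) (p : StrongDual 𝕜 D.l) : StrongDual 𝕜 D.l →L[𝕜] D.l :=
  (ContinuousLinearMap.fst 𝕜 D.l (StrongDual 𝕜 D.l)).comp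
    ((cothSubInv (D.subLQB.adDouble (0, p))).comp
      (ContinuousLinearMap.inr 𝕜 D.l (StrongDual 𝕜 D.l)))

/-- The canonical `ℓ`-matrix: for `α ∈ 𝔩*` and `ξ ∈ 𝔩^⊥`,
`l_p (s α + ξ) = rAM_p α - (p_𝔤 Ad_{e^{-sp}} i_𝔤)⁻¹ p_𝔤 Ad_{e^{-sp}} ξ`.
Every `η ∈ 𝔤*` is `s α + ξ` with `α = i* η` and `ξ = η - s (i* η) ∈ 𝔩^⊥`. -/
def lcan (D : ReductiveDecomposition G) (p : StrongDual 𝕜 D.l) : StrongDual 𝕜 V →L[𝕜] V :=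
  D.l.subtypeL.comp ((D.rAM p).comp D.restr)
    - (Ring.inverse (D.adBlock p)).comp
      ((ContinuousLinearMap.fst 𝕜 V (StrongDual 𝕜 V)).comp
        ((G.AdExp (-D.sDouble p)).comp
          ((ContinuousLinearMap.inr 𝕜 V (StrongDual 𝕜 V)).comp
            (ContinuousLinearMap.id 𝕜 (StrongDual 𝕜 V) - D.s.comp D.restr))))

/-! ### The algebroid `N(U) = U × 𝔩 × 𝔤*`

Sections over `U` are represented by maps on `𝔩*`, of which only the values on `U` matter. -/

/-- The anchor `a_p (z, ξ) = i* ξ - ad*_z p`. -/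
def anchor (D : ReductiveDecomposition G) (p : StrongDual 𝕜 D.l) (σ : D.l × StrongDual 𝕜 V) :
    StrongDual 𝕜 D.l :=
  D.restr σ.2 - D.subLQB.adStar σ.1 p

/-- `⟨ξ, d_p l(·) ξ'⟩`, the element of `𝔩 = (𝔩*)*` given by `α ↦ ⟨ξ, d_p l(α) ξ'⟩`. -/
def diffPairing (D : ReductiveDecomposition G)
    (l : StrongDual 𝕜 D.l → StrongDual 𝕜 V →L[𝕜] V) (p : StrongDual 𝕜 D.l)
    (ξ ξ' : StrongDual 𝕜 V) : D.l :=
  ofBidual (ξ.comp ((fderiv 𝕜 l p).flip ξ'))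

/-- The bracket at `p` of two sections of `N(U)`, for the Poisson groupoid given by `l`. -/
def bracketN (D : ReductiveDecomposition G) (l : StrongDual 𝕜 D.l → StrongDual 𝕜 V →L[𝕜] V)
    (σ σ' : StrongDual 𝕜 D.l → D.l × StrongDual 𝕜 V) (p : StrongDual 𝕜 D.l) :
    D.l × StrongDual 𝕜 V :=
  let z : D.l := (σ p).1
  let ξ : StrongDual 𝕜 V := (σ p).2
  let z' : D.l := (σ' p).1
  let ξ' : StrongDual 𝕜 V := (σ' p).2
  (fderiv 𝕜 (fun q => (σ' q).1) p (D.anchor p (σ p))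
      - fderiv 𝕜 (fun q => (σ q).1) p (D.anchor p (σ' p))
      - D.subLQB.bracket z z' + D.diffPairing l p ξ ξ',
    fderiv 𝕜 (fun q => (σ' q).2) p (D.anchor p (σ p))
      - fderiv 𝕜 (fun q => (σ q).2) p (D.anchor p (σ' p))
      + G.adStar z ξ' - G.adStar z' ξ + G.cocycleForm ξ ξ'
      + G.adStar (l p ξ) ξ' - G.adStar (l p ξ') ξ)

/-- A bundle map `θ : T U = U × 𝔩* → N(U)` is a flat connection if it is smooth, is a right inverse
of the anchor, and preserves brackets (with the bracket of vector fields on `U`). -/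
structure IsFlatConnection (D : ReductiveDecomposition G) (U : Set (StrongDual 𝕜 D.l))
    (l : StrongDual 𝕜 D.l → StrongDual 𝕜 V →L[𝕜] V)
    (θ : StrongDual 𝕜 D.l → StrongDual 𝕜 D.l →L[𝕜] D.l × StrongDual 𝕜 V) : Prop where
  smooth : ContDiffOn 𝕜 ∞ θ U
  anchor_apply : ∀ p ∈ U, ∀ α, D.anchor p (θ p α) = α
  flat : ∀ α β : StrongDual 𝕜 D.l → StrongDual 𝕜 D.l, ContDiffOn 𝕜 ∞ α U → ContDiffOn 𝕜 ∞ β U →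
    ∀ p ∈ U, D.bracketN l (fun q => θ q (α q)) (fun q => θ q (β q)) p
      = θ p (VectorField.lieBracket 𝕜 α β p)

/-- The inclusion `𝔩 ⊕ 𝔤* ⊆ 𝔤 ⊕ 𝔤*`. -/
def incl (D : ReductiveDecomposition G) : (D.l × StrongDual 𝕜 V) →L[𝕜] (V × StrongDual 𝕜 V) :=
  D.l.subtypeL.prodMap (ContinuousLinearMap.id 𝕜 (StrongDual 𝕜 V))

/-- The projection `𝔤 ⊕ 𝔤* → 𝔩 ⊕ 𝔤*` along `𝔪`, a left inverse of the inclusion. -/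
def proj (D : ReductiveDecomposition G) : (V × StrongDual 𝕜 V) →L[𝕜] (D.l × StrongDual 𝕜 V) :=
  D.projL.prodMap (ContinuousLinearMap.id 𝕜 (StrongDual 𝕜 V))

/-- `θ_p α = ((sinh ad_{sp} - ad_{sp}) / ad_{sp}² (s α), sinh ad_{sp} / ad_{sp} (s α))`, where the
first entry, an element of `𝔩 ⊆ 𝔡`, and the second one, an element of `𝔤* ⊆ 𝔡`, are read off by
the projections. -/
def theta (D : ReductiveDecomposition G) (p : StrongDual 𝕜 D.l) :
    StrongDual 𝕜 D.l →L[𝕜] D.l × StrongDual 𝕜 V :=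
  (D.projL.comp ((ContinuousLinearMap.fst 𝕜 V (StrongDual 𝕜 V)).comp
    ((sinhSubDivSq (G.adDouble (D.sDouble p))).comp D.sDouble))).prod
  ((ContinuousLinearMap.snd 𝕜 V (StrongDual 𝕜 V)).comp
    ((sinhDiv (G.adDouble (D.sDouble p))).comp D.sDouble))

/-- `𝔤^⋆_p = {z + ξ ∈ 𝔩 ⊕ 𝔤* | i* ξ = ad*_z p}`.
It is the kernel of the anchor at `p`; for `p = 0`, it is `𝔩 ⊕ 𝔩^⊥`. -/
def gStar (D : ReductiveDecomposition G) (p : StrongDual 𝕜 D.l) : Set (V × StrongDual 𝕜 V) :=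
  {X | ∃ σ : D.l × StrongDual 𝕜 V, D.restr σ.2 = D.subLQB.adStar σ.1 p ∧ D.incl σ = X}

/-- `φ_p = Ad_{e^{-sp}} τ_{l_p}`, as an endomorphism of `𝔤 ⊕ 𝔤*`. -/
def phi (D : ReductiveDecomposition G) (p : StrongDual 𝕜 D.l) :
    (V × StrongDual 𝕜 V) →L[𝕜] (V × StrongDual 𝕜 V) :=
  (G.AdExp (-D.sDouble p)).comp (twistMap (D.lcan p))

/-- `ψ_p X = - φ_p⁻¹ X`, read in `𝔩 ⊕ 𝔤*`. -/
def psi (D : ReductiveDecomposition G) (p : StrongDual 𝕜 D.l) :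
    (V × StrongDual 𝕜 V) →L[𝕜] (D.l × StrongDual 𝕜 V) :=
  -(D.proj.comp (Ring.inverse (D.phi p)))

end ReductiveDecomposition

end

noncomputable section

/-! Write A = ad_{sp} on the double 𝔡, B for the invariant pairing of 𝔡, and τ for the map z + ξ ↦ z
+ l_p ξ + ξ, which embeds the fibre of N(U) at p in 𝔡. The ℓ-matrix is made so that τ sends θα to Eα
= ((e^A - 1)/A) sα (`twist_theta`) and ψX to -e^A X (`twist_psi`). The first is the right
logarithmic derivative of p ↦ e^{sp}, the second is, up to sign, its adjoint action.

Under τ, the 𝔤*-component of the bracket of N(U) becomes a difference of derivatives minus the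
𝔤*-component of the bracket of 𝔡 (`bracketN_snd`). Its vanishing is the Maurer–Cartan equation for
two sections θα, θβ (`maurerCartan_expPrim_one`), and the formula d_v e^A = ad_{Ev} e^A for θα and
ψX (`fderiv_expPrim_zero_ad`).

The 𝔩-component involves the derivative of l, which is never computed. After pairing with γ ∈ 𝔩*,
the differentiated anchor relation and the skewness of l_p absorb it in B(Eα, d_γ Y), where Y is the
image under τ of the second section (`bracketN_theta_fst`). For two sections θα, θβ, the remaining
terms form the exterior derivative of the 2-form (sinh A - A)/A², which is half the pulled back
Cartan 3-form (`cyclic_fderiv_sinhSubDivSq`); as the vectors Eα span an isotropic subspace, the same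
3-form computes B(Eα, d_γ Eβ) (`form_fderiv_expTail_one`), and the two cancel. For θα and ψX,
transport by e^{-A} reduces the claim to the Maurer–Cartan equation at time -1.

All values land in the right summands because compatibility makes A preserve 𝔡 = (𝔩 ⊕ 𝔩*) ⊕ (𝔪 ⊕
𝔩^⊥) and exchange 𝔩 and 𝔩*: even functions of A preserve 𝔩 and 𝔩*, odd ones exchange them. The
spectral condition says that sinh A / A is invertible on 𝔩 ⊕ 𝔩* (`isUnit_sinhDiv_iff`). As A itself
need not be invertible, identities between quotients such as (e^A - 1)/A are proved by inserting a
time t and differentiating in t. General sections reduce to constant coefficients by the Leibniz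
rule (`bracketN_leibniz`). -/

theorem apply_apply_eq_neg_of_self {𝕜 E F : Type*} [RCLike 𝕜] [NormedAddCommGroup E]
    [NormedSpace 𝕜 E] [NormedAddCommGroup F] [NormedSpace 𝕜 F] {f : E →L[𝕜] E →L[𝕜] F}
    (h : ∀ x, f x x = 0) (x y : E) : f x y = -f y x := by
  have h1 := h (x + y)
  simp only [map_add, add_apply, h, zero_add, add_zero] at h1
  exact eq_neg_of_add_eq_zero_right h1

/-! ### The entire functions `∑ zⁿ / (n + k)!` -/

section ExpTail

variable {𝕜 : Type*} [RCLike 𝕜] {R : Type*} [NormedRing R] [NormedAlgebra 𝕜 R]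

variable (𝕜) in
/-- The entire function `∑ zⁿ / (n + k)!`, evaluated in a Banach algebra. -/
def expTail (k : ℕ) (a : R) : R := ∑' n : ℕ, ((n + k).factorial : 𝕜)⁻¹ • a ^ n

theorem norm_inv_factorial_add_le (k n : ℕ) :
    ‖((n + k).factorial : 𝕜)⁻¹‖ ≤ (n.factorial : ℝ)⁻¹ := by
  rw [norm_inv, RCLike.norm_natCast]
  exact inv_anti₀ (by positivity) (by exact_mod_cast Nat.factorial_le (Nat.le_add_right n k))

theorem summable_norm_smul_pow_of_le {c : ℕ → 𝕜} (hc : ∀ n, ‖c n‖ ≤ (n.factorial : ℝ)⁻¹) (a : R) :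
    Summable fun n => ‖c n • a ^ n‖ := by
  refine Summable.of_nonneg_of_le (fun _ => norm_nonneg _) (fun n => ?_)
    (NormedSpace.norm_expSeries_summable' (𝕂 := 𝕜) a)
  rw [norm_smul, norm_smul, norm_inv, RCLike.norm_natCast]
  exact mul_le_mul_of_nonneg_right (hc n) (norm_nonneg _)

variable [CompleteSpace R]

theorem hasSum_expTail (k : ℕ) (a : R) :
    HasSum (fun n : ℕ => ((n + k).factorial : 𝕜)⁻¹ • a ^ n) (expTail 𝕜 k a) :=
  (summable_norm_smul_pow_of_le (norm_inv_factorial_add_le k) a).of_norm.hasSum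

omit [CompleteSpace R] in
theorem expTail_zero_index (a : R) : expTail 𝕜 0 a = NormedSpace.exp a := by
  rw [NormedSpace.exp_eq_tsum 𝕜]; rfl

/-- By the ratio test the power series has infinite radius of convergence, so its sum is analytic on
the whole algebra. -/
theorem contDiff_expTail (k : ℕ) : ContDiff 𝕜 ∞ (expTail 𝕜 k : R → R) := by
  have hr : (FormalMultilinearSeries.ofScalars R
      (fun n : ℕ => ((n + k).factorial : 𝕜)⁻¹)).radius = ⊤ := by
    refine FormalMultilinearSeries.ofScalars_radius_eq_top_of_tendsto _ _
      (Filter.Eventually.of_forall fun n => inv_ne_zero (by exact_mod_cast Nat.factorial_ne_zero _)) ?_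
    have h : (fun n : ℕ => ‖((n.succ + k).factorial : 𝕜)⁻¹‖ / ‖((n + k).factorial : 𝕜)⁻¹‖)
        = fun n : ℕ => 1 / (((n + k : ℕ) : ℝ) + 1) := by
      funext n
      have : ((n + k).factorial : ℝ) ≠ 0 := by exact_mod_cast Nat.factorial_ne_zero _
      rw [Nat.succ_add, Nat.factorial_succ, norm_inv, norm_inv, RCLike.norm_natCast,
        RCLike.norm_natCast]
      push_cast
      field_simp
    rw [h]
    exact (tendsto_one_div_add_atTop_nhds_zero_nat (𝕜 := ℝ)).comp
      (Filter.tendsto_add_atTop_nat k)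
  have h := (FormalMultilinearSeries.ofScalars R
    (fun n : ℕ => ((n + k).factorial : 𝕜)⁻¹)).hasFPowerSeriesOnBall (by simp [hr])
  have he : (FormalMultilinearSeries.ofScalars R
      (fun n : ℕ => ((n + k).factorial : 𝕜)⁻¹)).sum = expTail 𝕜 k := by
    funext a
    exact FormalMultilinearSeries.ofScalars_sum_eq _ a
  rw [he, hr] at h
  have h2 : AnalyticOnNhd 𝕜 (expTail 𝕜 k : R → R) Set.univ := by
    intro a _
    exact h.analyticAt_of_mem (by simp)
  exact contDiffOn_univ.1 (h2.contDiffOn uniqueDiffOn_univ)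

omit [CompleteSpace R] in
theorem expTail_zero (k : ℕ) : expTail 𝕜 k (0 : R) = (k.factorial : 𝕜)⁻¹ • 1 := by
  rw [expTail, tsum_eq_single 0]
  · simp
  · intro n hn; simp [hn]

theorem mul_expTail_succ (k : ℕ) (a : R) :
    a * expTail 𝕜 (k + 1) a = expTail 𝕜 k a - (k.factorial : 𝕜)⁻¹ • 1 := by
  have h1 := (hasSum_expTail (𝕜 := 𝕜) (k + 1) a).mul_left a
  have h2 := (hasSum_nat_add_iff' 1).2 (hasSum_expTail (𝕜 := 𝕜) k a)
  simp only [Finset.sum_range_one, zero_add, pow_zero] at h2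
  refine h1.unique ?_
  convert! h2 using 2 with n
  rw [mul_smul_comm, ← pow_succ', show n + 1 + k = n + (k + 1) by ring]

/-- The factor `t ^ k` turns the k-th tail into an iterated primitive of e^{ta}, so that
differentiating in t lowers k by one. The series is differentiated term by term. -/
theorem hasDerivAt_pow_smul_expTail (k : ℕ) (a : R) (t : 𝕜) :
    HasDerivAt (fun t : 𝕜 => t ^ (k + 1) • expTail 𝕜 (k + 1) (t • a))
      (t ^ k • expTail 𝕜 k (t • a)) t := by
  have key : ∀ (k : ℕ) (t : 𝕜), t ^ k • expTail 𝕜 k (t • a)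
      = ∑' n : ℕ, (((n + k).factorial : 𝕜)⁻¹ * t ^ (n + k)) • a ^ n := by
    intro k t
    rw [← ((hasSum_expTail (𝕜 := 𝕜) k (t • a)).const_smul (t ^ k)).tsum_eq]
    refine tsum_congr fun n => ?_
    rw [smul_pow, smul_smul, smul_smul, pow_add]
    ring_nf
  simp_rw [key]
  -- The ball of radius ‖t‖ + 1 contains 0 and t. On it the differentiated series is dominated by
  -- the exponential series of r a.
  set r : ℝ := ‖t‖ + 1
  have hr : 0 ≤ r := by positivity
  have hder : ∀ (n : ℕ) (y : 𝕜), y ∈ Metric.ball (0 : 𝕜) r →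
      HasDerivAt (fun y : 𝕜 => (((n + (k + 1)).factorial : 𝕜)⁻¹ * y ^ (n + (k + 1))) • a ^ n)
        ((((n + k).factorial : 𝕜)⁻¹ * y ^ (n + k)) • a ^ n) y := by
    intro n y _
    have h := ((hasDerivAt_pow (n + (k + 1)) y).const_mul
      ((n + (k + 1)).factorial : 𝕜)⁻¹).smul_const (a ^ n)
    convert! h using 2
    have h1 : ((n + k).factorial : 𝕜) ≠ 0 := by exact_mod_cast Nat.factorial_ne_zero _
    have h2 : ((n + k + 1 : ℕ) : 𝕜) ≠ 0 := by exact_mod_cast (n + k).succ_ne_zero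
    rw [show n + (k + 1) = n + k + 1 by ring, Nat.factorial_succ, Nat.cast_mul,
      Nat.add_sub_cancel]
    field_simp
  have hb : ∀ n : ℕ, ∀ y ∈ Metric.ball (0 : 𝕜) r,
      ‖(((n + k).factorial : 𝕜)⁻¹ * y ^ (n + k)) • a ^ n‖
        ≤ r ^ k * ‖((n.factorial : 𝕜)⁻¹) • ((r : 𝕜) • a) ^ n‖ := by
    intro n y hy
    have hy' : ‖y‖ ≤ r := (mem_ball_zero_iff.1 hy).le
    rw [norm_smul, norm_mul, norm_smul, smul_pow, norm_smul, norm_pow y, norm_pow (r : 𝕜), norm_inv,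
      norm_inv, RCLike.norm_natCast, RCLike.norm_natCast, RCLike.norm_ofReal, abs_of_nonneg hr]
    calc ((n + k).factorial : ℝ)⁻¹ * ‖y‖ ^ (n + k) * ‖a ^ n‖
        ≤ (n.factorial : ℝ)⁻¹ * r ^ (n + k) * ‖a ^ n‖ := by
          gcongr
          exact Nat.le_add_right n k
      _ = _ := by ring
  refine hasDerivAt_tsum_of_isPreconnected
    ((NormedSpace.norm_expSeries_summable' (𝕂 := 𝕜) ((r : 𝕜) • a)).mul_left (r ^ k))
    Metric.isOpen_ball (convex_ball (0 : 𝕜) r).isPreconnected hder hb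
    (y₀ := 0) (by simp [r]; positivity) ?_ (by simp [r])
  refine summable_of_ne_finset_zero (s := ∅) fun n _ => ?_
  simp

/-- Formally e^{-a}(e^a - 1)/a = (1 - e^{-a})/a. Since `a` may not be invertible, both sides are
rescaled by t; they then have the same derivative in t and agree at t = 0. -/
theorem exp_neg_mul_expTail_one (a : R) :
    NormedSpace.exp (-a) * expTail 𝕜 1 a = expTail 𝕜 1 (-a) := by
  have hE : ∀ (b : R) (t : 𝕜), HasDerivAt (fun t : 𝕜 => t • expTail 𝕜 1 (t • b))
      (NormedSpace.exp (t • b)) t := by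
    intro b t
    simpa [expTail_zero_index] using hasDerivAt_pow_smul_expTail (𝕜 := 𝕜) 0 b t
  have hd : ∀ t : 𝕜, HasDerivAt (fun t : 𝕜 => NormedSpace.exp (t • (-a)) * (t • expTail 𝕜 1 (t • a))
      - t • expTail 𝕜 1 (t • (-a))) 0 t := by
    intro t
    have h := ((hasDerivAt_exp_smul_const (𝕂 := 𝕜) (-a) t).mul (hE a t)).sub (hE (-a) t)
    convert! h using 1
    have h1 := mul_expTail_succ (𝕜 := 𝕜) 0 (t • a)
    simp only [zero_add, expTail_zero_index, Nat.factorial_zero, Nat.cast_one, inv_one,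
      one_smul] at h1
    have h2 : -a * (t • expTail 𝕜 1 (t • a)) = 1 - NormedSpace.exp (t • a) := by
      rw [mul_smul_comm, neg_mul, smul_neg, ← smul_mul_assoc, h1]; abel
    rw [mul_assoc, h2]
    noncomm_ring
  have h := is_const_of_deriv_eq_zero (fun t => (hd t).differentiableAt) (fun t => (hd t).deriv)
    (1 : 𝕜) 0
  simpa [sub_eq_zero] using h

omit [CompleteSpace R] in
-- With the odd counterpart, this expresses the hyperbolic functions as half sums and half
-- differences of exponential tails at `a` and `-a`.
theorem hasSum_even_part {c : ℕ → 𝕜} {a x y : R} (hx : HasSum (fun n => c n • a ^ n) x)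
    (hy : HasSum (fun n => c n • (-a) ^ n) y) :
    HasSum (fun n => c (2 * n) • a ^ (2 * n)) ((2 : 𝕜)⁻¹ • (x + y)) := by
  have h := (hx.add hy).const_smul (2 : 𝕜)⁻¹
  have hinj : Function.Injective fun n : ℕ => 2 * n := fun m n h => by simpa using h
  rw [← hinj.hasSum_iff] at h
  · convert! h using 2 with n
    simp only [Function.comp, (even_two_mul n).neg_pow, ← two_smul 𝕜, smul_smul]
    rw [← mul_assoc, inv_mul_cancel₀ two_ne_zero, one_mul]
  · intro n hn
    have : Odd n := by
      by_contra h'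
      obtain ⟨m, hm⟩ := (Nat.not_odd_iff_even.1 h').two_dvd
      exact hn ⟨m, hm.symm⟩
    simp [this.neg_pow]

omit [CompleteSpace R] in
theorem hasSum_odd_part {c : ℕ → 𝕜} {a x y : R} (hx : HasSum (fun n => c n • a ^ n) x)
    (hy : HasSum (fun n => c n • (-a) ^ n) y) :
    HasSum (fun n => c (2 * n + 1) • a ^ (2 * n + 1)) ((2 : 𝕜)⁻¹ • (x - y)) := by
  have h := (hx.sub hy).const_smul (2 : 𝕜)⁻¹
  have hinj : Function.Injective fun n : ℕ => 2 * n + 1 := fun m n h => by simpa using h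
  rw [← hinj.hasSum_iff] at h
  · convert! h using 2 with n
    simp only [Function.comp, (odd_two_mul_add_one n).neg_pow, smul_neg, sub_neg_eq_add,
      ← two_smul 𝕜, smul_smul]
    rw [← mul_assoc, inv_mul_cancel₀ two_ne_zero, one_mul]
  · intro n hn
    have : Even n := by
      by_contra h'
      obtain ⟨m, hm⟩ := Nat.not_even_iff_odd.1 h'
      exact hn ⟨m, hm.symm⟩
    simp [this.neg_pow]

end ExpTail

/-! ### Exchange of a parameter derivative and a differential -/

section MixedPartials

variable {𝕜 : Type*} [RCLike 𝕜] {P F : Type*} [NormedAddCommGroup P] [NormedSpace 𝕜 P]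
  [NormedAddCommGroup F] [NormedSpace 𝕜 F]

/-- The derivative in a parameter commutes with the differential. -/
theorem hasDerivAt_fderiv_of_contDiff {f f' : 𝕜 → P → F}
    (hf : ContDiff 𝕜 ∞ fun x : 𝕜 × P => f x.1 x.2)
    (hf' : ∀ t q, HasDerivAt (fun t => f t q) (f' t q) t) (t : 𝕜) (p v : P) :
    HasDerivAt (fun t => fderiv 𝕜 (f t) p v) (fderiv 𝕜 (f' t) p v) t := by
  set g : 𝕜 × P → F := fun x => f x.1 x.2 with hg
  have hd : Differentiable 𝕜 g := hf.differentiable (by simp)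
  have hd2 : Differentiable 𝕜 (fderiv 𝕜 g) :=
    (hf.fderiv_right (m := ∞) (by simp)).differentiable (by simp)
  have h1 : ∀ t, fderiv 𝕜 (f t) p v = fderiv 𝕜 g (t, p) (0, v) := by
    intro t
    have h : HasFDerivAt (f t) ((fderiv 𝕜 g (t, p)).comp (ContinuousLinearMap.inr 𝕜 𝕜 P)) p :=
      (hd (t, p)).hasFDerivAt.comp p (hasFDerivAt_prodMk_right t p)
    rw [h.fderiv]; simp
  have h2 : ∀ q, f' t q = fderiv 𝕜 g (t, q) (1, 0) := by
    intro q
    have h : HasFDerivAt (fun t => f t q)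
        ((fderiv 𝕜 g (t, q)).comp (ContinuousLinearMap.inl 𝕜 𝕜 P)) t :=
      HasFDerivAt.comp (g := g) (f := fun s => (s, q)) t (hd (t, q)).hasFDerivAt (hasFDerivAt_prodMk_left t q)
    rw [(hf' t q).unique h.hasDerivAt]; simp
  have h3 : HasDerivAt (fun t => fderiv 𝕜 g (t, p) (0, v))
      (fderiv 𝕜 (fderiv 𝕜 g) (t, p) (1, 0) (0, v)) t := by
    have h : HasFDerivAt (fun t => fderiv 𝕜 g (t, p))
        ((fderiv 𝕜 (fderiv 𝕜 g) (t, p)).comp (ContinuousLinearMap.inl 𝕜 𝕜 P)) t :=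
      (hd2 (t, p)).hasFDerivAt.comp t (hasFDerivAt_prodMk_left t p)
    have h' := (h.hasDerivAt).clm_apply (hasDerivAt_const t ((0, v) : 𝕜 × P))
    simpa using h'
  have h4 : HasFDerivAt (fun q => fderiv 𝕜 g (t, q) (1, 0))
      (((fderiv 𝕜 (fderiv 𝕜 g) (t, p)).comp (ContinuousLinearMap.inr 𝕜 𝕜 P)).flip (1, 0)) p := by
    have h : HasFDerivAt (fun q => fderiv 𝕜 g (t, q))
        ((fderiv 𝕜 (fderiv 𝕜 g) (t, p)).comp (ContinuousLinearMap.inr 𝕜 𝕜 P)) p :=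
      (hd2 (t, p)).hasFDerivAt.comp p (hasFDerivAt_prodMk_right t p)
    have h' := h.clm_apply (hasFDerivAt_const ((1, 0) : 𝕜 × P) p)
    simpa using h'
  -- The exchange of the two derivatives is the symmetry of the second differential of `g`.
  have hs : IsSymmSndFDerivAt 𝕜 g (t, p) :=
    hf.contDiffAt.isSymmSndFDerivAt (by
      rw [minSmoothness_of_isRCLikeNormedField]; exact WithTop.coe_le_coe.2 le_top)
  simp_rw [h1]
  rw [show f' t = fun q => fderiv 𝕜 g (t, q) (1, 0) from funext h2, h4.fderiv]
  convert! h3 using 1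
  simpa using hs (0, v) (1, 0)

end MixedPartials

/-! ### Iterated primitives of the exponential -/

section IteratedPrimitives

variable {𝕜 : Type*} [RCLike 𝕜] {R : Type*} [NormedRing R] [NormedAlgebra 𝕜 R] [CompleteSpace R]

/-- The `k`-th iterated primitive of `t ↦ e^{t a}`, vanishing to order `k` at `t = 0`. -/
def expPrim (k : ℕ) (t : 𝕜) (a : R) : R := t ^ k • expTail 𝕜 k (t • a)

omit [CompleteSpace R] in
theorem expPrim_zero_index (t : 𝕜) (a : R) : expPrim 0 t a = NormedSpace.exp (t • a) := by
  simp [expPrim, expTail_zero_index]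

omit [CompleteSpace R] in
theorem expPrim_succ_zero (k : ℕ) (a : R) : expPrim (k + 1) (0 : 𝕜) a = 0 := by
  simp [expPrim]

omit [CompleteSpace R] in
theorem expPrim_one_one (a : R) : expPrim 1 (1 : 𝕜) a = expTail 𝕜 1 a := by simp [expPrim]

omit [CompleteSpace R] in
theorem expPrim_one_neg_one (a : R) : expPrim 1 (-1 : 𝕜) a = -expTail 𝕜 1 (-a) := by
  simp [expPrim]

theorem hasDerivAt_expPrim_succ (k : ℕ) (a : R) (t : 𝕜) :
    HasDerivAt (fun t : 𝕜 => expPrim (k + 1) t a) (expPrim k t a) t :=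
  hasDerivAt_pow_smul_expTail k a t

theorem hasDerivAt_expPrim_zero (a : R) (t : 𝕜) :
    HasDerivAt (fun t : 𝕜 => expPrim 0 t a) (a * expPrim 0 t a) t := by
  simp_rw [expPrim_zero_index]
  exact hasDerivAt_exp_smul_const' a t

theorem hasDerivAt_expPrim_zero_neg (a : R) (t : 𝕜) :
    HasDerivAt (fun t : 𝕜 => expPrim 0 (-t) a) (-(expPrim 0 (-t) a * a)) t := by
  have hc : a * expPrim 0 (-t) a = expPrim 0 (-t) a * a := by
    rw [expPrim_zero_index]
    exact (((Commute.refl a).smul_right (-t)).exp_right).eq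
  rw [← hc]
  simpa [Function.comp_def] using (hasDerivAt_expPrim_zero a (-t)).scomp t (hasDerivAt_neg t)

theorem contDiff_expPrim (k : ℕ) : ContDiff 𝕜 ∞ fun x : 𝕜 × R => expPrim k x.1 x.2 :=
  (contDiff_fst.pow k).smul ((contDiff_expTail k).comp (contDiff_fst.smul contDiff_snd))

theorem mul_expPrim_one (t : 𝕜) (a : R) : a * expPrim 1 t a = expPrim 0 t a - 1 := by
  have h1 := mul_expTail_succ (𝕜 := 𝕜) 0 (t • a)
  simp only [zero_add, Nat.factorial_zero, Nat.cast_one, inv_one, one_smul] at h1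
  rw [expPrim, expPrim, pow_one, pow_zero, one_smul, ← h1, mul_smul_comm, smul_mul_assoc]

theorem expPrim_zero_neg_mul (t : 𝕜) (a : R) : expPrim 0 (-t) a * expPrim 0 t a = 1 := by
  let _ : NormedAlgebra ℚ R := NormedAlgebra.restrictScalars ℚ 𝕜 R
  rw [expPrim_zero_index, expPrim_zero_index, neg_smul,
    ← NormedSpace.exp_add_of_commute (Commute.refl _).neg_left]
  simp

/-- This is e^{-ta} ∫₀ᵗ e^{ua} du = ∫₀ᵗ e^{(u-t)a} du; the minus sign comes from the orientation of
the interval from 0 to -t. -/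
theorem expPrim_zero_neg_mul_expPrim_one (t : 𝕜) (a : R) :
    expPrim 0 (-t) a * expPrim 1 t a = -expPrim 1 (-t) a := by
  rw [expPrim_zero_index]
  simp only [expPrim, pow_one, neg_smul, mul_smul_comm, neg_neg]
  rw [exp_neg_mul_expTail_one]

end IteratedPrimitives

/-! ### Functional calculus: intertwiners, adjoints and hyperbolic functions -/

section OperatorCalculus

variable {𝕜 : Type*} [RCLike 𝕜] {E F : Type*} [NormedAddCommGroup E] [NormedSpace 𝕜 E]
  [CompleteSpace E] [NormedAddCommGroup F] [NormedSpace 𝕜 F] [CompleteSpace F]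

theorem expTail_intertwine {K : E →L[𝕜] F} {A : E →L[𝕜] E} {A' : F →L[𝕜] F}
    (h : ∀ x, K (A x) = A' (K x)) (k : ℕ) (x : E) :
    K (expTail 𝕜 k A x) = expTail 𝕜 k A' (K x) := by
  have hp : ∀ n : ℕ, K ((A ^ n) x) = (A' ^ n) (K x) := by
    intro n
    induction n with
    | zero => simp
    | succ n ih => rw [pow_succ', pow_succ', mul_apply_eq_comp,
        mul_apply_eq_comp, h, ih]
  have h1 := ((hasSum_expTail (𝕜 := 𝕜) k A).mapL (ContinuousLinearMap.apply 𝕜 E x)).mapL K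
  have h2 := (hasSum_expTail (𝕜 := 𝕜) k A').mapL (ContinuousLinearMap.apply 𝕜 F (K x))
  refine h1.unique ?_
  convert! h2 using 2 with n
  simp only [ContinuousLinearMap.apply_apply, map_smul, hp]

theorem expTail_adjoint {B : E →L[𝕜] F →L[𝕜] 𝕜} {A : E →L[𝕜] E} {A' : F →L[𝕜] F}
    (h : ∀ x y, B (A x) y = B x (A' y)) (k : ℕ) (x : E) (y : F) :
    B (expTail 𝕜 k A x) y = B x (expTail 𝕜 k A' y) := by
  have hp : ∀ n : ℕ, ∀ x y, B ((A ^ n) x) y = B x ((A' ^ n) y) := by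
    intro n
    induction n with
    | zero => simp
    | succ n ih =>
      intro x y
      rw [pow_succ', pow_succ, mul_apply_eq_comp, mul_apply_eq_comp, h, ih]
  have h1 := ((hasSum_expTail (𝕜 := 𝕜) k A).mapL (ContinuousLinearMap.apply 𝕜 E x)).mapL (B.flip y)
  have h2 := ((hasSum_expTail (𝕜 := 𝕜) k A').mapL (ContinuousLinearMap.apply 𝕜 F y)).mapL (B x)
  refine h1.unique ?_
  convert! h2 using 2 with n
  simp only [ContinuousLinearMap.apply_apply, ContinuousLinearMap.flip_apply, map_smul, hp]

/-- The partial sums stay in `W`, which is closed because it is finite dimensional. -/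
theorem expTail_mem [FiniteDimensional 𝕜 E] {A : E →L[𝕜] E} {W : Submodule 𝕜 E}
    (h : ∀ x ∈ W, A x ∈ W) (k : ℕ) {x : E} (hx : x ∈ W) : expTail 𝕜 k A x ∈ W := by
  have hp : ∀ n : ℕ, (A ^ n) x ∈ W := by
    intro n
    induction n with
    | zero => simpa
    | succ n ih => rw [pow_succ', mul_apply_eq_comp]; exact h _ ih
  have h1 := (hasSum_expTail (𝕜 := 𝕜) k A).mapL (ContinuousLinearMap.apply 𝕜 E x)
  refine W.closed_of_finiteDimensional.mem_of_tendsto h1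
    (Filter.Eventually.of_forall fun s => W.sum_mem fun n _ => ?_)
  exact W.smul_mem _ (hp n)

theorem hasSum_sinhDiv (A : E →L[𝕜] E) :
    HasSum (fun n : ℕ => ((2 * n + 1).factorial : 𝕜)⁻¹ • A ^ (2 * n)) (sinhDiv A) :=
  (hasSum_even_part (hasSum_expTail (𝕜 := 𝕜) 1 A) (hasSum_expTail 1 (-A))).summable.hasSum

theorem sinhDiv_eq (A : E →L[𝕜] E) :
    sinhDiv A = (2 : 𝕜)⁻¹ • (expTail 𝕜 1 A + expTail 𝕜 1 (-A)) :=
  (hasSum_even_part (hasSum_expTail (𝕜 := 𝕜) 1 A) (hasSum_expTail 1 (-A))).tsum_eq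

theorem sinhSubDivSq_eq (A : E →L[𝕜] E) :
    sinhSubDivSq A = (2 : 𝕜)⁻¹ • (expTail 𝕜 2 A - expTail 𝕜 2 (-A)) :=
  (hasSum_odd_part (hasSum_expTail (𝕜 := 𝕜) 2 A) (hasSum_expTail 2 (-A))).tsum_eq

/-- `(cosh A - 1) / A`. -/
def coshSubOneDiv (A : E →L[𝕜] E) : E →L[𝕜] E :=
  (2 : 𝕜)⁻¹ • (expTail 𝕜 1 A - expTail 𝕜 1 (-A))

/-- The numerator of coth z - 1/z splits as (cosh z - 1)/z minus (sinh z - z)/z². The second piece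
is the 𝔩-component of θ, which is why it cancels in `twist_theta`. -/
theorem coshSubSinhDivDiv_eq (A : E →L[𝕜] E) :
    coshSubSinhDivDiv A = coshSubOneDiv A - sinhSubDivSq A := by
  have h1 := hasSum_odd_part (hasSum_expTail (𝕜 := 𝕜) 1 A) (hasSum_expTail 1 (-A))
  have h2 := hasSum_odd_part (hasSum_expTail (𝕜 := 𝕜) 2 A) (hasSum_expTail 2 (-A))
  rw [sinhSubDivSq_eq, coshSubOneDiv, ← (h1.sub h2).tsum_eq, coshSubSinhDivDiv]
  exact tsum_congr fun n => sub_smul _ _ _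

theorem sinhDiv_add_coshSubOneDiv (A : E →L[𝕜] E) :
    sinhDiv A + coshSubOneDiv A = expTail 𝕜 1 A := by
  rw [sinhDiv_eq, coshSubOneDiv]; module

theorem sinhDiv_sub_coshSubOneDiv (A : E →L[𝕜] E) :
    sinhDiv A - coshSubOneDiv A = expTail 𝕜 1 (-A) := by
  rw [sinhDiv_eq, coshSubOneDiv]; module

theorem mul_sinhSubDivSq (A : E →L[𝕜] E) : A * sinhSubDivSq A = sinhDiv A - 1 := by
  have h1 := mul_expTail_succ (𝕜 := 𝕜) 1 A
  have h2 := mul_expTail_succ (𝕜 := 𝕜) 1 (-A)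
  rw [neg_mul] at h2
  rw [sinhSubDivSq_eq, sinhDiv_eq, mul_smul_comm, mul_sub, h1,
    show A * expTail 𝕜 (1 + 1) (-A) = -(expTail 𝕜 1 (-A) - ((1 : ℕ).factorial : 𝕜)⁻¹ • 1) by
      rw [← h2, neg_neg]]
  simp only [Nat.factorial_one, Nat.cast_one, inv_one, one_smul]
  module

theorem sinhDiv_neg (A : E →L[𝕜] E) : sinhDiv (-A) = sinhDiv A := by
  rw [sinhDiv_eq, sinhDiv_eq, neg_neg, add_comm]

theorem sinhSubDivSq_neg (A : E →L[𝕜] E) : sinhSubDivSq (-A) = -sinhSubDivSq A := by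
  rw [sinhSubDivSq_eq, sinhSubDivSq_eq, neg_neg]; module

omit [CompleteSpace E] in
theorem coshSubOneDiv_neg (A : E →L[𝕜] E) : coshSubOneDiv (-A) = -coshSubOneDiv A := by
  rw [coshSubOneDiv, coshSubOneDiv, neg_neg]; module

theorem sinhDiv_intertwine {K : E →L[𝕜] F} {A : E →L[𝕜] E} {A' : F →L[𝕜] F}
    (h : ∀ x, K (A x) = A' (K x)) (x : E) : K (sinhDiv A x) = sinhDiv A' (K x) := by
  have h' : ∀ x, K ((-A) x) = (-A') (K x) := fun x => by simp [h]
  simp [sinhDiv_eq, expTail_intertwine h, expTail_intertwine h']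

theorem sinhSubDivSq_intertwine {K : E →L[𝕜] F} {A : E →L[𝕜] E} {A' : F →L[𝕜] F}
    (h : ∀ x, K (A x) = A' (K x)) (x : E) : K (sinhSubDivSq A x) = sinhSubDivSq A' (K x) := by
  have h' : ∀ x, K ((-A) x) = (-A') (K x) := fun x => by simp [h]
  simp [sinhSubDivSq_eq, expTail_intertwine h, expTail_intertwine h']

theorem coshSubOneDiv_intertwine {K : E →L[𝕜] F} {A : E →L[𝕜] E} {A' : F →L[𝕜] F}
    (h : ∀ x, K (A x) = A' (K x)) (x : E) : K (coshSubOneDiv A x) = coshSubOneDiv A' (K x) := by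
  have h' : ∀ x, K ((-A) x) = (-A') (K x) := fun x => by simp [h]
  simp [coshSubOneDiv, expTail_intertwine h, expTail_intertwine h']

theorem contDiff_sinhDiv : ContDiff 𝕜 ∞ (sinhDiv : (E →L[𝕜] E) → E →L[𝕜] E) := by
  rw [show (sinhDiv : (E →L[𝕜] E) → E →L[𝕜] E) = _ from funext sinhDiv_eq]
  exact ((contDiff_expTail 1).add ((contDiff_expTail 1).comp contDiff_neg)).const_smul _

theorem contDiff_sinhSubDivSq : ContDiff 𝕜 ∞ (sinhSubDivSq : (E →L[𝕜] E) → E →L[𝕜] E) := by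
  rw [show (sinhSubDivSq : (E →L[𝕜] E) → E →L[𝕜] E) = _ from funext sinhSubDivSq_eq]
  exact ((contDiff_expTail 2).sub ((contDiff_expTail 2).comp contDiff_neg)).const_smul _

theorem contDiff_coshSubOneDiv : ContDiff 𝕜 ∞ (coshSubOneDiv : (E →L[𝕜] E) → E →L[𝕜] E) :=
  ((contDiff_expTail 1).sub ((contDiff_expTail 1).comp contDiff_neg)).const_smul _

theorem contDiff_coshSubSinhDivDiv :
    ContDiff 𝕜 ∞ (coshSubSinhDivDiv : (E →L[𝕜] E) → E →L[𝕜] E) := by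
  rw [show (coshSubSinhDivDiv : (E →L[𝕜] E) → E →L[𝕜] E) = _ from funext coshSubSinhDivDiv_eq]
  exact contDiff_coshSubOneDiv.sub contDiff_sinhSubDivSq

end OperatorCalculus

/-! ### The Maurer--Cartan form of the exponential map -/

section MaurerCartan

variable {𝕜 : Type*} [RCLike 𝕜] {𝔡 P : Type*} [NormedAddCommGroup 𝔡] [NormedSpace 𝕜 𝔡]
  [CompleteSpace 𝔡] [NormedAddCommGroup P] [NormedSpace 𝕜 P]
  {ad : 𝔡 →L[𝕜] 𝔡 →L[𝕜] 𝔡} (j : P →L[𝕜] 𝔡)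

theorem contDiff_expPrim_ad (k : ℕ) :
    ContDiff 𝕜 ∞ fun x : 𝕜 × P => expPrim k x.1 (ad (j x.2)) :=
  (contDiff_expPrim k).comp
    (contDiff_fst.prodMk ((ad.comp j).contDiff.comp contDiff_snd))

theorem differentiable_expPrim_ad (k : ℕ) (t : 𝕜) :
    Differentiable 𝕜 fun q : P => expPrim k t (ad (j q)) :=
  ((contDiff_expPrim_ad j k).comp (contDiff_const.prodMk contDiff_id)).differentiable (by simp)

theorem hasDerivAt_fderiv_expPrim_succ (k : ℕ) (t : 𝕜) (p v : P) :
    HasDerivAt (fun t => fderiv 𝕜 (fun q => expPrim (k + 1) t (ad (j q))) p v)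
      (fderiv 𝕜 (fun q => expPrim k t (ad (j q))) p v) t :=
  hasDerivAt_fderiv_of_contDiff (f := fun t q => expPrim (k + 1) t (ad (j q)))
    (contDiff_expPrim_ad j _) (fun t _ => hasDerivAt_expPrim_succ k _ t) t p v

/-- By the Jacobi identity ad_z is a derivation, so e^{-t ad_z}[e^{t ad_z} x, e^{t ad_z} y] has zero
derivative in t. -/
theorem exp_ad_apply_bracket (hjac : ∀ x y z, ad x (ad y z) = ad (ad x y) z + ad y (ad x z))
    (t : 𝕜) (z x y : 𝔡) :
    expPrim 0 t (ad z) (ad x y) = ad (expPrim 0 t (ad z) x) (expPrim 0 t (ad z) y) := by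
  have hd : ∀ t : 𝕜, HasDerivAt (fun t => expPrim 0 (-t) (ad z)
      (ad (expPrim 0 t (ad z) x) (expPrim 0 t (ad z) y))) 0 t := by
    intro t
    have h1 : ∀ x, HasDerivAt (fun t : 𝕜 => expPrim 0 t (ad z) x)
        (ad z (expPrim 0 t (ad z) x)) t := fun x => by
      simpa using (hasDerivAt_expPrim_zero (ad z) t).clm_apply (hasDerivAt_const t x)
    have h2 := (hasDerivAt_expPrim_zero_neg (ad z) t).clm_apply ((ad.hasFDerivAt.comp_hasDerivAt t (h1 x)).clm_apply (h1 y))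
    convert! h2 using 1
    simp only [Function.comp_apply, neg_apply, mul_apply_eq_comp]
    rw [hjac z, map_add, neg_add_cancel]
  have h := is_const_of_deriv_eq_zero (fun t => (hd t).differentiableAt) (fun t => (hd t).deriv) t 0
  have h' := congrArg (fun y => expPrim 0 t (ad z) y) h
  have h3 := expPrim_zero_neg_mul (-t) (ad z)
  rw [neg_neg] at h3
  have h4 : ∀ y, expPrim 0 t (ad z) (expPrim 0 (-t) (ad z) y) = y := fun y => by
    rw [← mul_apply_eq_comp, h3]; rfl
  simp only [h4] at h'
  simpa [expPrim_zero_index] using h'.symm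

/-- The differential of the exponential map: `d_v e^{t A} = ad_{E v} e^{t A}` with
`E = (e^{t A} - 1) / A`. -/
theorem fderiv_expPrim_zero_ad
    (hjac : ∀ x y z, ad x (ad y z) = ad (ad x y) z + ad y (ad x z)) (t : 𝕜) (p v : P) :
    fderiv 𝕜 (fun q => expPrim 0 t (ad (j q))) p v
      = ad (expPrim 1 t (ad (j p)) (j v)) * expPrim 0 t (ad (j p)) := by
  set A := ad (j p) with hA
  -- Both sides of the formula solve the linear equation X' = ad_{jv} e^{tA} + A X with X(0) = 0:
  -- `hD` for the left side, `hW` for the right side.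
  have hD : ∀ t : 𝕜, HasDerivAt (fun t => fderiv 𝕜 (fun q => expPrim 0 t (ad (j q))) p v)
      (ad (j v) * expPrim 0 t A + A * fderiv 𝕜 (fun q => expPrim 0 t (ad (j q))) p v) t := by
    intro t
    have h := hasDerivAt_fderiv_of_contDiff (f := fun t q => expPrim 0 t (ad (j q)))
      (contDiff_expPrim_ad j _) (fun t _ => hasDerivAt_expPrim_zero _ t) t p v
    convert! h using 1
    have h1 : HasFDerivAt (fun q => ad (j q)) (ad.comp j) p := (ad.comp j).hasFDerivAt
    have h2 := h1.mul' (differentiable_expPrim_ad (ad := ad) j 0 t p).hasFDerivAt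
    rw [show (fun q => ad (j q) * expPrim 0 t (ad (j q)))
      = (fun q => ad (j q)) * fun q => expPrim 0 t (ad (j q)) from rfl, h2.fderiv]
    simp [add_comm, A]
  have hcomm : ∀ x, A * ad x - ad x * A = ad (A x) := by
    intro x
    ext y
    simp [A, hjac (j p) x y]
  have hW : ∀ t : 𝕜, HasDerivAt (fun t => ad (expPrim 1 t A (j v)) * expPrim 0 t A)
      (ad (j v) * expPrim 0 t A + A * (ad (expPrim 1 t A (j v)) * expPrim 0 t A)) t := by
    intro t
    have h1 : HasDerivAt (fun t : 𝕜 => expPrim 1 t A (j v)) (expPrim 0 t A (j v)) t := by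
      simpa using (hasDerivAt_expPrim_succ 0 A t).clm_apply (hasDerivAt_const t (j v))
    have h2 := (ad.hasFDerivAt.comp_hasDerivAt t h1).mul (hasDerivAt_expPrim_zero A t)
    convert! h2 using 1
    -- The commutator of A with ad_{Ev} is ad_{AEv}, and A E v = e^{tA} v - v; this produces the
    -- inhomogeneous term.
    have h3 := hcomm (expPrim 1 t A (j v))
    rw [← mul_apply_eq_comp, mul_expPrim_one] at h3
    simp only [sub_apply, one_apply_eq_self, map_sub] at h3
    rw [← mul_assoc, ← mul_assoc, sub_eq_iff_eq_add.1 h3]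
    simp only [Function.comp_apply]
    noncomm_ring
  -- Variation of constants: e^{-tA} times the difference of two solutions is constant.
  have hd : ∀ t : 𝕜, HasDerivAt (fun t => expPrim 0 (-t) A *
      (fderiv 𝕜 (fun q => expPrim 0 t (ad (j q))) p v
        - ad (expPrim 1 t A (j v)) * expPrim 0 t A)) 0 t := by
    intro t
    convert! (hasDerivAt_expPrim_zero_neg A t).mul ((hD t).sub (hW t)) using 1
    simp only [Pi.sub_apply]
    noncomm_ring
  have h := is_const_of_deriv_eq_zero (fun t => (hd t).differentiableAt) (fun t => (hd t).deriv) t 0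
  have h' := congrArg (fun x => expPrim 0 t A * x) h
  have h3 := expPrim_zero_neg_mul (-t) A
  rw [neg_neg] at h3
  simp only [← mul_assoc, h3, one_mul] at h'
  have h4 : ∀ a : 𝔡 →L[𝕜] 𝔡, expPrim 0 (0 : 𝕜) a = 1 := fun a => by simp [expPrim_zero_index]
  have h5 : expPrim 1 (0 : 𝕜) A = 0 := expPrim_succ_zero 0 A
  rw [sub_eq_iff_eq_add] at h'
  simpa [h4, h5] using h'

/-- The Maurer--Cartan equation for `E = (e^{t A} - 1) / A`. -/
theorem maurerCartan_expPrim_one (hself : ∀ x, ad x x = 0)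
    (hjac : ∀ x y z, ad x (ad y z) = ad (ad x y) z + ad y (ad x z)) (t : 𝕜) (p v w : P) :
    fderiv 𝕜 (fun q => expPrim 1 t (ad (j q))) p v (j w)
      - fderiv 𝕜 (fun q => expPrim 1 t (ad (j q))) p w (j v)
      = ad (expPrim 1 t (ad (j p)) (j v)) (expPrim 1 t (ad (j p)) (j w)) := by
  have hskew := apply_apply_eq_neg_of_self hself
  -- In the t-derivative, differentials of E become differentials of e^{tA}, which are known; the
  -- result is the t-derivative of [Ev, Ew]. At t = 0 everything vanishes.
  have hd : ∀ t : 𝕜, HasDerivAt (fun t => fderiv 𝕜 (fun q => expPrim 1 t (ad (j q))) p v (j w)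
      - fderiv 𝕜 (fun q => expPrim 1 t (ad (j q))) p w (j v)
      - ad (expPrim 1 t (ad (j p)) (j v)) (expPrim 1 t (ad (j p)) (j w))) 0 t := by
    intro t
    have h1 : ∀ v w, HasDerivAt (fun t => fderiv 𝕜 (fun q => expPrim 1 t (ad (j q))) p v (j w))
        (fderiv 𝕜 (fun q => expPrim 0 t (ad (j q))) p v (j w)) t := fun v w => by
      simpa using (hasDerivAt_fderiv_expPrim_succ (ad := ad) j 0 t p v).clm_apply
        (hasDerivAt_const t (j w))
    have h2 : ∀ x, HasDerivAt (fun t : 𝕜 => expPrim 1 t (ad (j p)) x)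
        (expPrim 0 t (ad (j p)) x) t := fun x => by
      simpa using (hasDerivAt_expPrim_succ 0 (ad (j p)) t).clm_apply (hasDerivAt_const t x)
    have h3 := ((h1 v w).sub (h1 w v)).sub
      ((ad.hasFDerivAt.comp_hasDerivAt t (h2 (j v))).clm_apply (h2 (j w)))
    convert! h3 using 1
    rw [fderiv_expPrim_zero_ad j hjac, fderiv_expPrim_zero_ad j hjac]
    simp only [mul_apply_eq_comp, Function.comp_apply]
    rw [hskew (expPrim 1 t (ad (j p)) (j w))]
    abel
  have h := is_const_of_deriv_eq_zero (fun t => (hd t).differentiableAt) (fun t => (hd t).deriv) t 0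
  have h5 : ∀ a : 𝔡 →L[𝕜] 𝔡, expPrim 1 (0 : 𝕜) a = 0 := expPrim_succ_zero 0
  simp only [h5, fderiv_fun_const] at h
  simpa [sub_eq_zero] using h

end MaurerCartan

/-! ### Invariant pairing and the Cartan 3-form -/

section InvariantForm

variable {𝕜 : Type*} [RCLike 𝕜] {𝔡 P : Type*} [NormedAddCommGroup 𝔡] [NormedSpace 𝕜 𝔡]
  [CompleteSpace 𝔡] [NormedAddCommGroup P] [NormedSpace 𝕜 P]
  {ad : 𝔡 →L[𝕜] 𝔡 →L[𝕜] 𝔡} {B : 𝔡 →L[𝕜] 𝔡 →L[𝕜] 𝕜} (j : P →L[𝕜] 𝔡)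

/-- Taking adjoints replaces A by -A, hence t by -t; the sign compensates for the prefactor `t ^ k`.
-/
theorem expPrim_adjoint (k : ℕ) {A : 𝔡 →L[𝕜] 𝔡} (hA : ∀ x y, B (A x) y = -B x (A y)) (t : 𝕜)
    (x y : 𝔡) : B (expPrim k t A x) y = (-1) ^ k * B x (expPrim k (-t) A y) := by
  have h : ∀ x y, B ((t • A) x) y = B x ((-t • A) y) := fun x y => by simp [hA]
  have h1 : (t : 𝕜) ^ k = (-1) ^ k * (-t) ^ k := by rw [← mul_pow]; simp
  simp only [expPrim, smul_apply, map_smul, smul_eq_mul, expTail_adjoint h]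
  rw [h1]; ring

theorem fderiv_expPrim_one_adjoint (hinv : ∀ x y z, B (ad x y) z = -B y (ad x z))
    (t : 𝕜) (p v : P) (x y : 𝔡) :
    B (fderiv 𝕜 (fun q => expPrim 1 t (ad (j q))) p v x) y
      = -B x (fderiv 𝕜 (fun q => expPrim 1 (-t) (ad (j q))) p v y) := by
  have h1 := (((differentiable_expPrim_ad (ad := ad) j 1 t p).hasFDerivAt.clm_apply
    (hasFDerivAt_const x p)))
  have h2 := (((differentiable_expPrim_ad (ad := ad) j 1 (-t) p).hasFDerivAt.clm_apply
    (hasFDerivAt_const y p)))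
  have h3 := (B.flip y).hasFDerivAt.comp p h1
  have h4 := ((B x).hasFDerivAt.comp p h2).neg
  have he : (B.flip y ∘ fun q => expPrim 1 t (ad (j q)) x)
      = -(B x ∘ fun q => expPrim 1 (-t) (ad (j q)) y) := by
    funext q
    simpa using expPrim_adjoint 1 (hinv (j q)) t x y
  rw [he] at h3
  simpa using congrArg (fun L => L v) (h3.unique h4)

theorem exp_ad_isometry (hinv : ∀ x y z, B (ad x y) z = -B y (ad x z)) (t : 𝕜) (z x y : 𝔡) :
    B x (expPrim 0 t (ad z) y) = B (expPrim 0 (-t) (ad z) x) y := by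
  simpa using (expPrim_adjoint 0 (hinv z) (-t) x y).symm

/-- The pairing of `[E v, E w]` with `e^{t A} x`, where `E = (e^{t A} - 1) / A`. -/
theorem form_bracket_expPrim_one
    (hjac : ∀ x y z, ad x (ad y z) = ad (ad x y) z + ad y (ad x z))
    (hinv : ∀ x y z, B (ad x y) z = -B y (ad x z)) (t : 𝕜) (a x y z : 𝔡) :
    B (ad (expPrim 1 t (ad a) x) (expPrim 1 t (ad a) y)) (expPrim 0 t (ad a) z)
      = B (ad (expPrim 1 (-t) (ad a) x) (expPrim 1 (-t) (ad a) y)) z := by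
  -- Move e^{tA} to the bracket as e^{-tA}, which is an automorphism and sends E_t x to -E_{-t} x.
  -- The two signs cancel.
  rw [exp_ad_isometry hinv, exp_ad_apply_bracket hjac]
  have h : ∀ x, expPrim 0 (-t) (ad a) (expPrim 1 t (ad a) x) = -expPrim 1 (-t) (ad a) x := by
    intro x
    rw [← mul_apply_eq_comp, expPrim_zero_neg_mul_expPrim_one]; rfl
  simp [h]

/-- The exterior derivative of the `2`-form `((sinh A - A) / A²)` is the pull back of the
Cartan `3`-form. -/
theorem cyclic_fderiv_sinhSubDivSq (hself : ∀ x, ad x x = 0)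
    (hjac : ∀ x y z, ad x (ad y z) = ad (ad x y) z + ad y (ad x z))
    (hsymm : ∀ x y, B x y = B y x) (hinv : ∀ x y z, B (ad x y) z = -B y (ad x z)) (p u v w : P) :
    B (fderiv 𝕜 (fun q => sinhSubDivSq (ad (j q))) p u (j v)) (j w)
      + B (fderiv 𝕜 (fun q => sinhSubDivSq (ad (j q))) p v (j w)) (j u)
      + B (fderiv 𝕜 (fun q => sinhSubDivSq (ad (j q))) p w (j u)) (j v)
      = 2⁻¹ * B (ad (expTail 𝕜 1 (ad (j p)) (j u)) (expTail 𝕜 1 (ad (j p)) (j v)))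
          (expTail 𝕜 1 (ad (j p)) (j w)) := by
  have hskew := apply_apply_eq_neg_of_self hself
  have hcyc : ∀ x y z, B (ad x y) z = B (ad y z) x := by
    intro x y z
    rw [hskew x y, map_neg, neg_apply, hinv, neg_neg, hsymm]
  set M : 𝕜 → P → 𝔡 →L[𝕜] 𝔡 := fun t u =>
    fderiv 𝕜 (fun q => expPrim 1 t (ad (j q))) p u with hM
  set N : 𝕜 → P → 𝔡 →L[𝕜] 𝔡 := fun t u =>
    fderiv 𝕜 (fun q => expPrim 2 t (ad (j q))) p u with hN
  set E : 𝕜 → P → 𝔡 := fun t v => expPrim 1 t (ad (j p)) (j v) with hE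
  set e : 𝕜 → P → 𝔡 := fun t v => expPrim 0 t (ad (j p)) (j v) with he
  -- At t = 1, N(t) - N(-t) is twice the differential of (sinh A - A)/A². Its t-derivative involves
  -- only the differentials M(±t) of E.
  have hdN : ∀ t u v w, HasDerivAt (fun t => B (N t u (j v)) (j w) - B (N (-t) u (j v)) (j w))
      (B (M t u (j v)) (j w) + B (M (-t) u (j v)) (j w)) t := by
    intro t u v w
    have h1 : ∀ t, HasDerivAt (fun t => B (N t u (j v)) (j w)) (B (M t u (j v)) (j w)) t := by
      intro t
      have h2 : HasDerivAt (fun t => N t u (j v)) (M t u (j v)) t := by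
        simpa using (hasDerivAt_fderiv_expPrim_succ (ad := ad) j 1 t p u).clm_apply
          (hasDerivAt_const t (j v))
      exact (B.flip (j w)).hasFDerivAt.comp_hasDerivAt t h2
    have h3 := (h1 t).sub ((h1 (-t)).scomp t (hasDerivAt_neg t))
    convert! h3 using 1
    simp
  have hdE : ∀ t v, HasDerivAt (fun t => E t v) (e t v) t := fun t v => by
    simpa using (hasDerivAt_expPrim_succ 0 (ad (j p)) t).clm_apply (hasDerivAt_const t (j v))
  have hdR : ∀ t, HasDerivAt (fun t => B (ad (E t u) (E t v)) (E t w))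
      (B (ad (E (-t) u) (E (-t) v)) (j w) + B (ad (E (-t) v) (E (-t) w)) (j u)
        + B (ad (E (-t) w) (E (-t) u)) (j v)) t := by
    intro t
    have h1 := (ad.hasFDerivAt.comp_hasDerivAt t (hdE t u)).clm_apply (hdE t v)
    have h2 := (B.hasFDerivAt.comp_hasDerivAt t h1).clm_apply (hdE t w)
    convert! h2 using 1
    simp only [Function.comp_apply, map_add, add_apply]
    rw [hcyc (e t u), ← hcyc (E t w)]
    simp only [hE, he, form_bracket_expPrim_one hjac hinv]
    ring
  have hadj : ∀ t u v w, B (M t u (j v)) (j w) = -B (M (-t) u (j w)) (j v) := by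
    intro t u v w
    rw [fderiv_expPrim_one_adjoint j hinv, hsymm]
  have hmc : ∀ t u v w, B (M t u (j v)) (j w) - B (M t v (j u)) (j w)
      = B (ad (E t u) (E t v)) (j w) := by
    intro t u v w
    rw [← sub_apply, ← map_sub, maurerCartan_expPrim_one j hself hjac]
  have hd : ∀ t, HasDerivAt (fun t =>
      (B (N t u (j v)) (j w) - B (N (-t) u (j v)) (j w))
      + (B (N t v (j w)) (j u) - B (N (-t) v (j w)) (j u))
      + (B (N t w (j u)) (j v) - B (N (-t) w (j u)) (j v))
      - B (ad (E t u) (E t v)) (E t w)) 0 t := by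
    intro t
    convert! (((hdN t u v w).add (hdN t v w u)).add (hdN t w u v)).sub (hdR t) using 1
    -- Adjunction turns M(t) into -M(-t) with two arguments exchanged. The six terms then regroup in
    -- three instances of the Maurer–Cartan equation at time -t, which is what `hdR` gives.
    rw [hadj t u v w, hadj t v w u, hadj t w u v, ← hmc (-t), ← hmc (-t), ← hmc (-t)]
    ring
  have h := is_const_of_deriv_eq_zero (fun t => (hd t).differentiableAt) (fun t => (hd t).deriv)
    1 0
  have hT : ∀ u, fderiv 𝕜 (fun q => sinhSubDivSq (ad (j q))) p u
      = (2 : 𝕜)⁻¹ • (N 1 u - N (-1) u) := by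
    intro u
    have h1 := (((differentiable_expPrim_ad (ad := ad) j 2 1 p).hasFDerivAt.sub
      (differentiable_expPrim_ad (ad := ad) j 2 (-1) p).hasFDerivAt).const_smul (2 : 𝕜)⁻¹)
    have h2 : (fun q => sinhSubDivSq (ad (j q))) = (2 : 𝕜)⁻¹ •
        ((fun q => expPrim 2 (1 : 𝕜) (ad (j q))) - fun q => expPrim 2 (-1 : 𝕜) (ad (j q))) := by
      funext q
      simp [sinhSubDivSq_eq, expPrim]
    rw [h2, h1.fderiv]
    simp [hN]
  have hE1 : ∀ v, E 1 v = expTail 𝕜 1 (ad (j p)) (j v) := fun v => by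
    simp [hE, expPrim_one_one]
  have hE0 : ∀ v, E 0 v = 0 := fun v => by simp [hE, expPrim]
  simp only [neg_zero, sub_self, hE0, map_zero, add_zero, hE1] at h
  rw [sub_eq_zero] at h
  rw [← h, hT, hT, hT]
  simp only [smul_apply, sub_apply, map_smul, map_sub, smul_eq_mul]
  ring

/-- If the Maurer--Cartan form takes values in an isotropic subbundle, its differential is
determined by the Cartan `3`-form. -/
theorem form_fderiv_expTail_one (hself : ∀ x, ad x x = 0)
    (hjac : ∀ x y z, ad x (ad y z) = ad (ad x y) z + ad y (ad x z))
    (hsymm : ∀ x y, B x y = B y x) (hinv : ∀ x y z, B (ad x y) z = -B y (ad x z))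
    (hiso : ∀ p v w, B (expTail 𝕜 1 (ad (j p)) (j v)) (expTail 𝕜 1 (ad (j p)) (j w)) = 0)
    (p u v w : P) :
    B (fderiv 𝕜 (fun q => expTail 𝕜 1 (ad (j q))) p w (j u)) (expTail 𝕜 1 (ad (j p)) (j v))
      = 2⁻¹ * B (ad (expTail 𝕜 1 (ad (j p)) (j u)) (expTail 𝕜 1 (ad (j p)) (j v)))
          (expTail 𝕜 1 (ad (j p)) (j w)) := by
  have hskew := apply_apply_eq_neg_of_self hself
  have hcyc : ∀ x y z, B (ad x y) z = B (ad y z) x := by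
    intro x y z
    rw [hskew x y, map_neg, neg_apply, hinv, neg_neg, hsymm]
  set E : P → 𝔡 := fun v => expTail 𝕜 1 (ad (j p)) (j v) with hE
  -- A Koszul argument: g is skew in (u, v) by differentiating the isotropy condition, and its skew
  -- part in (u, w) is the Cartan 3-form by the Maurer–Cartan equation. These two facts determine g.
  set g : P → P → P → 𝕜 := fun u v w =>
    B (fderiv 𝕜 (fun q => expTail 𝕜 1 (ad (j q))) p w (j u)) (E v) with hg
  have hmc : ∀ u v w, g u v w - g w v u = B (ad (E u) (E v)) (E w) := by
    intro u v w
    have h := maurerCartan_expPrim_one j hself hjac (1 : 𝕜) p w u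
    simp only [expPrim_one_one] at h
    simp only [hg]
    rw [← sub_apply, ← map_sub, h, hcyc]
  have hanti : ∀ u v w, g u v w = -g v u w := by
    intro u v w
    have hd : ∀ x, HasFDerivAt (fun q => expTail 𝕜 1 (ad (j q)) x)
        ((fderiv 𝕜 (fun q => expTail 𝕜 1 (ad (j q))) p).flip x) p := by
      intro x
      have h0 : Differentiable 𝕜 fun q : P => expTail 𝕜 1 (ad (j q)) := by
        simpa only [expPrim_one_one] using differentiable_expPrim_ad (ad := ad) j 1 (1 : 𝕜)
      simpa using (h0 p).hasFDerivAt.clm_apply (hasFDerivAt_const x p)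
    have h1 := (B.hasFDerivAt.comp p (hd (j u))).clm_apply (hd (j v))
    have h2 := h1.unique (show HasFDerivAt _ (0 : P →L[𝕜] 𝕜) p from by
      simp only [Function.comp_apply, hiso]
      exact hasFDerivAt_const (0 : 𝕜) p)
    have h3 := congrArg (fun L => L w) h2
    simp only [Function.comp_apply, add_apply, ContinuousLinearMap.comp_apply,
      ContinuousLinearMap.flip_apply, zero_apply] at h3
    simp only [hg]
    rw [hsymm _ (E u)]
    linear_combination h3
  have h1 := hmc u v w
  have h2 := hmc v w u
  have h3 := hmc w u v
  have hc2 := hcyc (E v) (E w) (E u)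
  have h4 := hanti w v u
  have h5 := hanti u w v
  have h6 := hanti v u w
  change g u v w = 2⁻¹ * B (ad (E u) (E v)) (E w)
  rw [eq_comm, inv_mul_eq_iff_eq_mul₀ two_ne_zero]
  linear_combination -h1 + h2 - h3 - h4 + h5 - h6 + hc2

end InvariantForm

/-! ### The spectral condition -/

section Spectrum

theorem expTail_apply_of_eq_smul {𝕜 : Type*} [RCLike 𝕜] {E : Type*} [NormedAddCommGroup E]
    [NormedSpace 𝕜 E] [CompleteSpace E] {A : E →L[𝕜] E} {c : 𝕜} {x : E} (h : A x = c • x) (k : ℕ) :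
    expTail 𝕜 k A x = expTail 𝕜 k c • x := by
  have h1 := (hasSum_expTail (𝕜 := 𝕜) k A).mapL (ContinuousLinearMap.apply 𝕜 E x)
  have h2 := (hasSum_expTail (𝕜 := 𝕜) k c).smul_const x
  refine h1.unique ?_
  convert! h2 using 2 with n
  have hp : (A ^ n) x = c ^ n • x := by
    induction n with
    | zero => simp
    | succ n ih => rw [pow_succ', mul_apply_eq_comp, ih, map_smul, h, smul_smul, pow_succ]
  rw [ContinuousLinearMap.apply_apply, smul_apply, hp, smul_assoc]

/-- The left side is 2 sinh z / z. Its zeros are those of sinh except z = 0, where the value is 2;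
hence k ≠ 0. -/
theorem expTail_one_add_neg_eq_zero_iff (z : ℂ) :
    expTail ℂ 1 z + expTail ℂ 1 (-z) = 0 ↔ ∃ k : ℤ, k ≠ 0 ∧ z = Complex.I * Real.pi * k := by
  have h1 := mul_expTail_succ (𝕜 := ℂ) 0 z
  have h2 := mul_expTail_succ (𝕜 := ℂ) 0 (-z)
  simp only [zero_add, expTail_zero_index, ← Complex.exp_eq_exp_ℂ, Nat.factorial_zero,
    Nat.cast_one, inv_one, one_smul] at h1 h2
  have h3 : z * (expTail ℂ 1 z + expTail ℂ 1 (-z)) = 2 * Complex.sinh z := by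
    rw [Complex.two_sinh]
    linear_combination h1 - h2
  have hI : Complex.I * Complex.I = -1 := Complex.I_mul_I
  rcases eq_or_ne z 0 with rfl | hz
  · have h4 : expTail ℂ 1 (0 : ℂ) + expTail ℂ 1 (-0) = 2 := by
      rw [neg_zero, expTail_zero]
      norm_num
    rw [h4]
    refine iff_of_false two_ne_zero ?_
    rintro ⟨k, hk, h⟩
    simp [hk, Real.pi_ne_zero] at h
  · have h5 : expTail ℂ 1 z + expTail ℂ 1 (-z) = 0 ↔ Complex.sinh z = 0 := by
      rw [← mul_right_inj' hz, h3]; simp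
    rw [h5, show Complex.sinh z = 0 ↔ Complex.sin (z * Complex.I) = 0 by
      rw [Complex.sin_mul_I]; simp, Complex.sin_eq_zero_iff]
    constructor
    · rintro ⟨k, hk⟩
      have hz' : z = Complex.I * Real.pi * ((-k : ℤ) : ℂ) := by
        push_cast
        linear_combination (-Complex.I) * hk + z * hI
      refine ⟨-k, ?_, hz'⟩
      intro h0
      rw [h0] at hz'
      simp at hz'
      exact hz hz'
    · rintro ⟨k, _, hk⟩
      refine ⟨-k, ?_⟩
      rw [hk]; push_cast
      linear_combination (Real.pi * k : ℂ) * hI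

variable {𝕜 : Type*} [RCLike 𝕜] {E : Type*} [NormedAddCommGroup E] [NormedSpace 𝕜 E]
  [FiniteDimensional 𝕜 E]

theorem ContinuousLinearMap.isUnit_iff_det_ne_zero (A : E →L[𝕜] E) :
    IsUnit A ↔ LinearMap.det (A : E →ₗ[𝕜] E) ≠ 0 := by
  rw [← isUnit_iff_ne_zero, ← LinearMap.isUnit_iff_isUnit_det]
  exact (MulEquiv.isUnit_map (Module.End.toContinuousLinearMap (𝕜 := 𝕜) E).symm).symm

/-- The complexification of an endomorphism, in coordinates. -/
def complexify : (E →L[𝕜] E) →+* Module.End ℂ (Fin (Module.finrank 𝕜 E) → ℂ) :=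
  ((Matrix.toLinAlgEquiv' (R := ℂ) (n := Fin (Module.finrank 𝕜 E))).toRingEquiv.toRingHom.comp
    ((toComplexHom 𝕜).mapMatrix)).comp
    ((LinearMap.toMatrixAlgEquiv (Module.finBasis 𝕜 E)).toRingEquiv.toRingHom.comp
      ContinuousLinearMap.toLinearMapRingHom)

theorem complexify_apply (A : E →L[𝕜] E) :
    complexify A = Matrix.toLin' ((LinearMap.toMatrix (Module.finBasis 𝕜 E) (Module.finBasis 𝕜 E)
      (A : E →ₗ[𝕜] E)).map (toComplexHom 𝕜)) := rfl

theorem det_complexify (A : E →L[𝕜] E) :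
    LinearMap.det (complexify A) = toComplexHom 𝕜 (LinearMap.det (A : E →ₗ[𝕜] E)) := by
  rw [complexify_apply, LinearMap.det_toLin', ← LinearMap.det_toMatrix (Module.finBasis 𝕜 E),
    RingHom.map_det]
  rfl

theorem charpoly_complexify (A : E →L[𝕜] E) :
    (complexify A).charpoly = (A : E →ₗ[𝕜] E).charpoly.map (toComplexHom 𝕜) := by
  rw [complexify_apply, Matrix.charpoly_toLin', Matrix.charpoly_map, LinearMap.charpoly_toMatrix]

theorem mem_complexSpectrum_iff (A : E →L[𝕜] E) (z : ℂ) :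
    z ∈ complexSpectrum A ↔ (complexify A).HasEigenvalue z := by
  rw [Module.End.hasEigenvalue_iff_isRoot_charpoly, charpoly_complexify]
  rfl

theorem isUnit_complexify_iff (A : E →L[𝕜] E) :
    IsUnit (complexify A) ↔ IsUnit A := by
  rw [LinearMap.isUnit_iff_isUnit_det, det_complexify, ContinuousLinearMap.isUnit_iff_det_ne_zero,
    isUnit_iff_ne_zero, map_ne_zero]

theorem zero_notMem_complexSpectrum_iff (A : E →L[𝕜] E) :
    (0 : ℂ) ∉ complexSpectrum A ↔ IsUnit A := by
  rw [mem_complexSpectrum_iff, Module.End.hasEigenvalue_iff_mem_spectrum,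
    spectrum.zero_notMem_iff, isUnit_complexify_iff]

theorem complexify_smul (c : 𝕜) (A : E →L[𝕜] E) :
    complexify (c • A) = toComplexHom 𝕜 c • complexify A := by
  rw [complexify_apply, complexify_apply, ← map_smul]
  congr 1
  ext i j
  simp

theorem continuous_complexify : Continuous fun A : E →L[𝕜] E =>
    LinearMap.toContinuousLinearMap (complexify A) := by
  have hc : Continuous (toComplexHom 𝕜) := by
    have : (toComplexHom 𝕜 : 𝕜 → ℂ)
        = fun x => (RCLike.re x : ℂ) + (RCLike.im x : ℂ) * Complex.I := by
      funext x
      apply Complex.ext <;> simp [toComplexHom]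
    rw [this]
    fun_prop
  refine (LinearMap.continuous_of_finiteDimensional
    ((LinearMap.toContinuousLinearMap.toLinearMap ∘ₗ (Matrix.toLin' (R := ℂ)
      (m := Fin (Module.finrank 𝕜 E)) (n := Fin (Module.finrank 𝕜 E))).toLinearMap))).comp
    (f := fun A : E →L[𝕜] E => (LinearMap.toMatrix (Module.finBasis 𝕜 E) (Module.finBasis 𝕜 E)
      (A : E →ₗ[𝕜] E)).map (toComplexHom 𝕜)) ?_
  refine continuous_pi fun i => continuous_pi fun k => ?_
  refine hc.comp ?_
  simp only [LinearMap.toMatrix_apply]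
  exact (LinearMap.continuous_of_finiteDimensional
    ((Module.finBasis 𝕜 E).coord i)).comp
    (ContinuousLinearMap.apply 𝕜 E (Module.finBasis 𝕜 E k)).continuous

theorem complexify_sinhDiv (A : E →L[𝕜] E) :
    complexify (sinhDiv A) = sinhDiv (LinearMap.toContinuousLinearMap (complexify A)) := by
  have := FiniteDimensional.complete 𝕜 E
  let Ψ : (E →L[𝕜] E) →+ ((Fin (Module.finrank 𝕜 E) → ℂ) →L[ℂ] (Fin (Module.finrank 𝕜 E) → ℂ)) :=
    { toFun := fun A => LinearMap.toContinuousLinearMap (complexify A)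
      map_zero' := by simp
      map_add' := by simp }
  have h1 := (hasSum_sinhDiv A).map Ψ continuous_complexify
  have h2 := hasSum_sinhDiv (𝕜 := ℂ) (LinearMap.toContinuousLinearMap (complexify A))
  have h3 : Ψ (sinhDiv A) = sinhDiv (LinearMap.toContinuousLinearMap (complexify A)) := by
    refine h1.unique ?_
    convert! h2 using 2 with n
    change LinearMap.toContinuousLinearMap (complexify _) = _
    rw [complexify_smul, map_pow, map_inv₀, map_natCast, map_smul]
    congr 1
    exact map_pow (Module.End.toContinuousLinearMap (𝕜 := ℂ) _) _ _
  exact congrArg ContinuousLinearMap.toLinearMap h3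

/-- A spectral mapping argument after complexification. An eigenvector for iπk with k ≠ 0 is killed
by sinh A / A. Conversely, the kernel of sinh A / A is A-invariant; if nonzero, it contains an
eigenvector of A, whose eigenvalue must be a zero of sinh z / z. -/
theorem isUnit_sinhDiv_iff (A : E →L[𝕜] E) :
    IsUnit (sinhDiv A) ↔
      ∀ k : ℤ, k ≠ 0 → Complex.I * Real.pi * k ∉ complexSpectrum A := by
  have := FiniteDimensional.complete 𝕜 E
  set f := complexify A with hf
  have hN : ∀ (z : ℂ) v, f v = z • v → complexify (sinhDiv A) v
      = ((2 : ℂ)⁻¹ * (expTail ℂ 1 z + expTail ℂ 1 (-z))) • v := by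
    intro z v hv
    have h1 : LinearMap.toContinuousLinearMap f v = z • v := hv
    have h2 : (-LinearMap.toContinuousLinearMap f) v = (-z) • v := by
      rw [neg_apply, h1, neg_smul]
    rw [complexify_sinhDiv, sinhDiv_eq, ContinuousLinearMap.coe_coe, smul_apply, add_apply,
      expTail_apply_of_eq_smul h1, expTail_apply_of_eq_smul h2, ← add_smul, smul_smul]
  rw [← isUnit_complexify_iff, LinearMap.isUnit_iff_ker_eq_bot]
  constructor
  · intro h k hk hmem
    obtain ⟨v, hv⟩ := ((mem_complexSpectrum_iff A _).1 hmem).exists_hasEigenvector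
    refine hv.2 ((Submodule.mem_bot ℂ).1 (h ▸ ?_))
    rw [LinearMap.mem_ker, hN _ v hv.apply_eq_smul,
      (expTail_one_add_neg_eq_zero_iff _).2 ⟨k, hk, rfl⟩]
    simp
  · intro h
    by_contra hker
    set W := LinearMap.ker (complexify (sinhDiv A)) with hW
    have hinv : ∀ x ∈ W, f x ∈ W := by
      intro x hx
      rw [hW, LinearMap.mem_ker, complexify_sinhDiv] at hx ⊢
      have h1 := sinhDiv_intertwine (K := LinearMap.toContinuousLinearMap f) (fun _ => rfl) x
      rw [← hf, ContinuousLinearMap.coe_coe] at hx ⊢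
      rw [hx, map_zero] at h1
      exact h1.symm
    have : Nontrivial W := Submodule.nontrivial_iff_ne_bot.2 hker
    obtain ⟨z, hz⟩ := Module.End.exists_eigenvalue (f.restrict hinv)
    obtain ⟨v, hv⟩ := hz.exists_hasEigenvector
    have hv1 : f v = z • (v : Fin (Module.finrank 𝕜 E) → ℂ) := by
      simpa using congrArg Subtype.val hv.apply_eq_smul
    have hv0 : (v : Fin (Module.finrank 𝕜 E) → ℂ) ≠ 0 := by simpa using hv.2
    have h1 := hN z v hv1
    rw [LinearMap.mem_ker.1 v.2, eq_comm, smul_eq_zero, or_iff_left hv0] at h1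
    obtain ⟨k, hk, hzk⟩ := (expTail_one_add_neg_eq_zero_iff z).1 (by simpa using h1)
    refine h k hk ((mem_complexSpectrum_iff A _).2 ?_)
    rw [← hzk]
    exact Module.End.hasEigenvalue_of_hasEigenvector
      (x := (v : Fin (Module.finrank 𝕜 E) → ℂ)) ⟨Module.End.mem_eigenspace_iff.2 hv1, hv0⟩

end Spectrum

/-! ### The double and its canonical pairing -/

/-- An injective endomorphism of the finite-dimensional `W` is onto. This is how inverses are seen
to respect the summands of the double. -/
theorem exists_mem_apply_eq_of_isUnit {𝕜 : Type*} [RCLike 𝕜] {E : Type*} [NormedAddCommGroup E]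
    [NormedSpace 𝕜 E] [FiniteDimensional 𝕜 E] {f : E →L[𝕜] E} (hf : IsUnit f) {W : Submodule 𝕜 E}
    (h : ∀ x ∈ W, f x ∈ W) {y : E} (hy : y ∈ W) : ∃ x ∈ W, f x = y := by
  obtain ⟨g, rfl⟩ := hf
  have hinj : Function.Injective ((g : E →L[𝕜] E) : E →ₗ[𝕜] E) := by
    intro a b hab
    have hg : ∀ x, (↑g⁻¹ : E →L[𝕜] E) ((g : E →L[𝕜] E) x) = x := fun x => by
      rw [← mul_apply_eq_comp, Units.inv_mul]; rfl
    rw [← hg a, ← hg b]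
    exact congrArg _ hab
  have hsurj := LinearMap.surjective_of_injective
    (f := ((g : E →L[𝕜] E) : E →ₗ[𝕜] E).restrict h)
    (fun a b hab => Subtype.ext (hinj (congrArg Subtype.val hab)))
  obtain ⟨x, hx⟩ := hsurj ⟨y, hy⟩
  exact ⟨x, x.2, congrArg Subtype.val hx⟩

theorem Ring.inverse_apply_apply {𝕜 : Type*} [RCLike 𝕜] {E : Type*} [NormedAddCommGroup E]
    [NormedSpace 𝕜 E] {f : E →L[𝕜] E} (hf : IsUnit f) (x : E) : Ring.inverse f (f x) = x := by
  rw [← mul_apply_eq_comp, Ring.inverse_mul_cancel f hf]; rfl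

theorem Ring.apply_inverse_apply {𝕜 : Type*} [RCLike 𝕜] {E : Type*} [NormedAddCommGroup E]
    [NormedSpace 𝕜 E] {f : E →L[𝕜] E} (hf : IsUnit f) (x : E) : f (Ring.inverse f x) = x := by
  rw [← mul_apply_eq_comp, Ring.mul_inverse_cancel f hf]; rfl

namespace LQBData

variable {𝕜 : Type*} [RCLike 𝕜] {V : Type*} [NormedAddCommGroup V] [NormedSpace 𝕜 V]
  [FiniteDimensional 𝕜 V]

/-- The bracket of the double, as a continuous bilinear map. -/
def adL (G : LQBData 𝕜 V) :
    (V × StrongDual 𝕜 V) →L[𝕜] (V × StrongDual 𝕜 V) →L[𝕜] (V × StrongDual 𝕜 V) :=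
  LinearMap.toContinuousLinearMap
    { toFun := fun X => G.adDouble X
      map_add' := fun X Y => by
        ext Z <;> simp [adDouble, doubleBracket, adStar, cocycleForm] <;> abel
      map_smul' := fun c X => by
        ext Z <;> simp [adDouble, doubleBracket, adStar, cocycleForm, smul_add, smul_sub] }

theorem adL_apply_apply (G : LQBData 𝕜 V) (X Y : V × StrongDual 𝕜 V) :
    G.adL X Y = G.doubleBracket X Y := rfl

variable (𝕜 V) in
/-- The canonical pairing of the double. -/
def form : (V × StrongDual 𝕜 V) →L[𝕜] (V × StrongDual 𝕜 V) →L[𝕜] 𝕜 :=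
  let b := (ContinuousLinearMap.id 𝕜 (StrongDual 𝕜 V)).bilinearComp
    (ContinuousLinearMap.snd 𝕜 V (StrongDual 𝕜 V)) (ContinuousLinearMap.fst 𝕜 V (StrongDual 𝕜 V))
  b + b.flip

omit [FiniteDimensional 𝕜 V] in
theorem form_apply (X Y : V × StrongDual 𝕜 V) : form 𝕜 V X Y = X.2 Y.1 + Y.2 X.1 := by
  simp [form]

omit [FiniteDimensional 𝕜 V] in
theorem form_symm (X Y : V × StrongDual 𝕜 V) : form 𝕜 V X Y = form 𝕜 V Y X := by
  rw [form_apply, form_apply, add_comm]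

variable {G : LQBData 𝕜 V}

namespace IsLieQuasiBialgebra

omit [FiniteDimensional 𝕜 V] in
theorem bracket_skew (hG : G.IsLieQuasiBialgebra) (x y : V) : G.bracket x y = -G.bracket y x := by
  have h := hG.bracket_self (x + y)
  simp only [map_add, add_apply, hG.bracket_self, zero_add, add_zero] at h
  exact eq_neg_of_add_eq_zero_right h

theorem adL_self (hG : G.IsLieQuasiBialgebra) (X : V × StrongDual 𝕜 V) : G.adL X X = 0 :=
  hG.double_self X

theorem adL_jacobi (hG : G.IsLieQuasiBialgebra) (X Y Z : V × StrongDual 𝕜 V) :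
    G.adL X (G.adL Y Z) = G.adL (G.adL X Y) Z + G.adL Y (G.adL X Z) :=
  hG.double_jacobi X Y Z

/-- Invariance of the canonical pairing: the terms in [,] cancel by definition of ad* and skewness
of the bracket, those in ϖ and φ by their skewness. -/
theorem form_adL (hG : G.IsLieQuasiBialgebra) (X Y Z : V × StrongDual 𝕜 V) :
    form 𝕜 V (G.adL X Y) Z = -form 𝕜 V Y (G.adL X Z) := by
  simp only [form_apply, adL_apply_apply, doubleBracket, adStar, cocycleForm, add_apply, sub_apply,
    map_add, map_sub, ContinuousLinearMap.comp_apply, ContinuousLinearMap.flip_apply]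
  rw [hG.bracket_skew Y.1 Z.1, map_neg]
  linear_combination hG.cocycle_skew X.1 Z.2 Y.2 + hG.assoc_skew_right X.2 Y.2 Z.2

end IsLieQuasiBialgebra

end LQBData

/-! ### The double split along the reductive decomposition -/

namespace ReductiveDecomposition

open LQBData

variable {𝕜 : Type*} [RCLike 𝕜] {V : Type*} [NormedAddCommGroup V] [NormedSpace 𝕜 V]
  [FiniteDimensional 𝕜 V] {G : LQBData 𝕜 V} (D : ReductiveDecomposition G)

instance : CompleteSpace D.l := FiniteDimensional.complete 𝕜 D.l

theorem projL_coe (z : D.l) : D.projL (z : V) = z :=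
  Submodule.projectionOnto_apply_left D.isCompl z

theorem projL_eq_zero_iff (x : V) : D.projL x = 0 ↔ x ∈ D.m :=
  Submodule.projectionOnto_apply_eq_zero_iff D.isCompl

theorem projL_of_mem_m {x : V} (hx : x ∈ D.m) : D.projL x = 0 := (D.projL_eq_zero_iff x).2 hx

theorem sub_projL_mem (x : V) : x - D.projL x ∈ D.m := by
  rw [← projL_eq_zero_iff, map_sub, projL_coe, sub_self]

theorem s_apply (α : StrongDual 𝕜 D.l) (x : V) : D.s α x = α (D.projL x) := rfl

omit [FiniteDimensional 𝕜 V] in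
theorem restr_apply (ξ : StrongDual 𝕜 V) (z : D.l) : D.restr ξ z = ξ z := rfl

theorem s_apply_coe (α : StrongDual 𝕜 D.l) (z : D.l) : D.s α z = α z := by
  rw [s_apply, projL_coe]

theorem s_apply_of_mem_m (α : StrongDual 𝕜 D.l) {x : V} (hx : x ∈ D.m) : D.s α x = 0 := by
  rw [s_apply, D.projL_of_mem_m hx, map_zero]

theorem restr_s (α : StrongDual 𝕜 D.l) : D.restr (D.s α) = α := by
  ext z
  rw [restr_apply, s_apply_coe]

omit [FiniteDimensional 𝕜 V] in
theorem restr_eq_zero_iff (ξ : StrongDual 𝕜 V) : D.restr ξ = 0 ↔ ∀ z ∈ D.l, ξ z = 0 := by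
  constructor
  · intro h z hz
    exact congrArg (fun β : StrongDual 𝕜 D.l => β ⟨z, hz⟩) h
  · intro h
    ext z
    exact h z z.2

/-- An element on which `𝔩^⊥` vanishes is in `𝔩`. -/
theorem coe_projL_eq_of_forall {x : V}
    (h : ∀ ζ : StrongDual 𝕜 V, (∀ z ∈ D.l, ζ z = 0) → ζ x = 0) : (D.projL x : V) = x := by
  have h1 : ∀ ζ : StrongDual 𝕜 V, ζ (x - D.projL x) = 0 := by
    intro ζ
    have h2 := h (ζ.comp (ContinuousLinearMap.id 𝕜 V - D.l.subtypeL.comp D.projL)) (fun z hz => by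
      have := D.projL_coe ⟨z, hz⟩
      simp only [ContinuousLinearMap.comp_apply, sub_apply, ContinuousLinearMap.id_apply] at this ⊢
      rw [this]; simp)
    simpa using h2
  have h3 : x - D.projL x = 0 := by
    rw [← (Module.forall_dual_apply_eq_zero_iff 𝕜 (x - (D.projL x : V)))]
    exact fun f => h1 (LinearMap.toContinuousLinearMap f)
  exact (sub_eq_zero.1 h3).symm

/-- An element on which `𝔪^⊥` vanishes is in `𝔪`. -/
theorem mem_m_of_forall {x : V} (h : ∀ α : StrongDual 𝕜 D.l, D.s α x = 0) : x ∈ D.m := by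
  rw [← projL_eq_zero_iff, ← (Module.forall_dual_apply_eq_zero_iff 𝕜 (D.projL x))]
  exact fun f => h (LinearMap.toContinuousLinearMap f)

/-- The inclusion of the double of `𝔩` in the double of `𝔤`. -/
def kappa : (D.l × StrongDual 𝕜 D.l) →L[𝕜] (V × StrongDual 𝕜 V) :=
  D.l.subtypeL.prodMap D.s

theorem kappa_apply (X : D.l × StrongDual 𝕜 D.l) : D.kappa X = ((X.1 : V), D.s X.2) := rfl

theorem kappa_inr (α : StrongDual 𝕜 D.l) : D.kappa (0, α) = D.sDouble α := rfl

theorem sDouble_apply (α : StrongDual 𝕜 D.l) : D.sDouble α = (0, D.s α) := rfl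

/-- The complement `𝔪 ⊕ 𝔩^⊥` of the double of `𝔩`. -/
def mPerp : Submodule 𝕜 (V × StrongDual 𝕜 V) :=
  D.m.prod (LinearMap.ker (D.restr : StrongDual 𝕜 V →ₗ[𝕜] StrongDual 𝕜 D.l))

/-- As [𝔩, 𝔪] ⊆ 𝔪, the projection to 𝔩 is 𝔩-equivariant, and hence so is its transpose. -/
theorem adStar_s (p : StrongDual 𝕜 D.l) (z : D.l) :
    G.adStar z (D.s p) = D.s (D.subLQB.adStar z p) := by
  ext y
  have h := D.coe_subLQB_bracket z (D.projL y)
  have h1 : G.bracket z y = D.subLQB.bracket z (D.projL y) + G.bracket z (y - D.projL y) := by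
    rw [h, map_sub]; abel
  change D.s p (G.bracket z y) = p (D.subLQB.bracket z (D.projL y))
  rw [h1, map_add, s_apply_coe, D.s_apply_of_mem_m _ (D.bracket_l_m z z.2 _ (D.sub_projL_mem y)),
    add_zero]

variable {D} (hG : G.IsLieQuasiBialgebra) (hD : D.IsCanonicallyCompatible)

include hD in
-- Each compatibility condition removes one obstruction: ϖ vanishes on 𝔩, the form ⟨sα, ϖ_• sp⟩ is
-- zero, and φ(sp, sα) lies in 𝔩 for lack of an 𝔩 ∧ 𝔩 ∧ 𝔪 component. Functions of ad_{sp} on the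
-- image of κ are therefore computed in the double of 𝔩.
theorem adL_sDouble_kappa (p : StrongDual 𝕜 D.l) (X : D.l × StrongDual 𝕜 D.l) :
    G.adL (D.sDouble p) (D.kappa X) = D.kappa (D.subLQB.adL (0, p) X) := by
  have hs : ∀ (α : StrongDual 𝕜 D.l), ∀ y ∈ D.m, D.s α y = 0 := fun α y => D.s_apply_of_mem_m α
  have h1 : (D.projL (G.assoc (D.s p) (D.s X.2)) : V) = G.assoc (D.s p) (D.s X.2) :=
    D.coe_projL_eq_of_forall fun ζ hζ => hD.assoc_llm _ _ _ (hs p) (hs X.2) hζ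
  have h2 : G.cocycle (X.1 : V) = 0 := hD.cocycle_l _ X.1.2
  have h3 : G.cocycleForm (D.s X.2) (D.s p) = 0 := by
    ext x
    exact hD.cocycle_m_perp _ _ (hs X.2) (hs p) x
  rw [adL_apply_apply, adL_apply_apply, kappa_apply, kappa_apply, sDouble_apply]
  simp only [doubleBracket, h2, h3, adStar_s]
  ext y
  · simp [subLQB, h1]
  · simp [adStar, cocycleForm, subLQB]

include hD in
theorem adL_sDouble_coe (p : StrongDual 𝕜 D.l) (z : D.l) :
    G.adL (D.sDouble p) ((z : V), 0) = (0, D.s (D.subLQB.adStar z p)) := by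
  rw [← adStar_s, adL_apply_apply, sDouble_apply]
  simp [doubleBracket, hD.cocycle_l _ z.2, adStar, cocycleForm]

include hG hD in
-- The subspace is orthogonal to 𝔩 ⊕ s𝔩* for the canonical pairing; the same conditions that
-- preserve one preserve the other.
theorem adL_sDouble_mem_mPerp (p : StrongDual 𝕜 D.l) {X : V × StrongDual 𝕜 V} (hX : X ∈ D.mPerp) :
    G.adL (D.sDouble p) X ∈ D.mPerp := by
  have hs : ∀ (α : StrongDual 𝕜 D.l), ∀ y ∈ D.m, D.s α y = 0 := fun α y => D.s_apply_of_mem_m α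
  have hX2 := (D.restr_eq_zero_iff _).1 hX.2
  rw [adL_apply_apply, sDouble_apply]
  constructor
  · refine D.mem_m_of_forall fun α => ?_
    have h1 := hD.cocycle_m_perp _ _ (hs α) (hs p) X.1
    have h2 : D.s α (G.assoc (D.s p) X.2) = 0 := by
      rw [hG.assoc_skew_right, hD.assoc_llm _ _ _ (hs p) (hs α) hX2, neg_zero]
    simp [doubleBracket, h1, h2]
  · refine (D.restr_eq_zero_iff _).2 fun z hz => ?_
    have h1 : D.s p (G.bracket X.1 z) = 0 := by
      rw [hG.bracket_skew, map_neg, hs p _ (D.bracket_l_m z hz _ hX.1), neg_zero]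
    simp [doubleBracket, adStar, cocycleForm, h1, hD.cocycle_l z hz]

end ReductiveDecomposition

theorem eq_zero_of_neg_eq_self (𝕜 : Type*) [RCLike 𝕜] {F : Type*} [AddCommGroup F] [Module 𝕜 F]
    {x : F} (h : -x = x) : x = 0 := by
  have h2 : (2 : 𝕜) • x = 0 := by
    rw [two_smul]
    nth_rewrite 1 [← h]
    exact neg_add_cancel x
  exact (smul_eq_zero.1 h2).resolve_left two_ne_zero

theorem contDiff_ad_comp {𝕜 P E : Type*} [RCLike 𝕜] [NormedAddCommGroup P] [NormedSpace 𝕜 P]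
    [NormedAddCommGroup E] [NormedSpace 𝕜 E] (ad : E →L[𝕜] E →L[𝕜] E) (j : P →L[𝕜] E) :
    ContDiff 𝕜 ∞ fun p => ad (j p) :=
  (ad.comp j).contDiff

theorem isOpen_setOf_isUnit {𝕜 P E : Type*} [RCLike 𝕜] [TopologicalSpace P]
    [NormedAddCommGroup E] [NormedSpace 𝕜 E] [CompleteSpace E] {f : P → E →L[𝕜] E}
    (hf : Continuous f) : IsOpen {p | IsUnit (f p)} :=
  Units.isOpen.preimage hf

theorem contDiffOn_ringInverse_of_isUnit {𝕜 P E : Type*} [RCLike 𝕜] [NormedAddCommGroup P]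
    [NormedSpace 𝕜 P] [NormedAddCommGroup E] [NormedSpace 𝕜 E] [CompleteSpace E]
    {f : P → E →L[𝕜] E} {s : Set P} (hf : ContDiffOn 𝕜 ∞ f s) (hu : ∀ p ∈ s, IsUnit (f p)) :
    ContDiffOn 𝕜 ∞ (fun p => Ring.inverse (f p)) s := by
  intro p hp
  obtain ⟨u, hu⟩ := hu p hp
  exact ContDiffAt.comp_contDiffWithinAt p (hu ▸ contDiffAt_ringInverse 𝕜 u) (hf p hp)

namespace ReductiveDecomposition

open LQBData

variable {𝕜 : Type*} [RCLike 𝕜] {V : Type*} [NormedAddCommGroup V] [NormedSpace 𝕜 V]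
  [FiniteDimensional 𝕜 V] {G : LQBData 𝕜 V} (D : ReductiveDecomposition G)

/-! ### Parity -/

/-- The involution of the double of `𝔩` that is `-1` on `𝔩` and `1` on `𝔩*`. -/
def parity : (D.l × StrongDual 𝕜 D.l) →L[𝕜] (D.l × StrongDual 𝕜 D.l) :=
  (-ContinuousLinearMap.id 𝕜 D.l).prodMap (ContinuousLinearMap.id 𝕜 (StrongDual 𝕜 D.l))

omit [FiniteDimensional 𝕜 V] in
theorem parity_apply (X : D.l × StrongDual 𝕜 D.l) : D.parity X = (-X.1, X.2) := rfl

theorem subLQB_adL_apply (p : StrongDual 𝕜 D.l) (X : D.l × StrongDual 𝕜 D.l) :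
    D.subLQB.adL (0, p) X = (D.subLQB.assoc p X.2, D.subLQB.adStar X.1 p) := by
  rw [adL_apply_apply]
  ext y <;> simp [doubleBracket, adStar, cocycleForm, subLQB]

/-- In the double of 𝔩, whose cocycle is zero, ad_p exchanges 𝔩 and 𝔩*, so it anticommutes with the
involution. Even functions of ad_p thus preserve the two summands and odd ones exchange them. -/
theorem parity_adL (p : StrongDual 𝕜 D.l) (X : D.l × StrongDual 𝕜 D.l) :
    D.parity (D.subLQB.adL (0, p) X) = (-D.subLQB.adL (0, p)) (D.parity X) := by
  rw [neg_apply, subLQB_adL_apply, subLQB_adL_apply, parity_apply, parity_apply]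
  ext <;> simp [adStar]

theorem sinhDiv_adL_inr (p α : StrongDual 𝕜 D.l) :
    (sinhDiv (D.subLQB.adL (0, p)) (0, α)).1 = 0 := by
  have h := sinhDiv_intertwine (D.parity_adL p) (0, α)
  rw [sinhDiv_neg, parity_apply, parity_apply] at h
  have h1 := congrArg Prod.fst h
  simp only [neg_zero] at h1
  exact eq_zero_of_neg_eq_self 𝕜 h1

theorem sinhDiv_adL_inl (p : StrongDual 𝕜 D.l) (z : D.l) :
    (sinhDiv (D.subLQB.adL (0, p)) (z, 0)).2 = 0 := by
  have h := sinhDiv_intertwine (D.parity_adL p) (z, 0)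
  rw [sinhDiv_neg, parity_apply, parity_apply, show ((-z, 0) : D.l × StrongDual 𝕜 D.l) = -(z, 0) by
    simp, map_neg] at h
  exact eq_zero_of_neg_eq_self 𝕜 (congrArg Prod.snd h).symm

theorem sinhSubDivSq_adL_inr (p α : StrongDual 𝕜 D.l) :
    (sinhSubDivSq (D.subLQB.adL (0, p)) (0, α)).2 = 0 := by
  have h := sinhSubDivSq_intertwine (D.parity_adL p) (0, α)
  rw [sinhSubDivSq_neg, parity_apply, parity_apply, neg_zero, neg_apply] at h
  exact eq_zero_of_neg_eq_self 𝕜 (congrArg Prod.snd h).symm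

theorem coshSubOneDiv_adL_inr (p α : StrongDual 𝕜 D.l) :
    (coshSubOneDiv (D.subLQB.adL (0, p)) (0, α)).2 = 0 := by
  have h := coshSubOneDiv_intertwine (D.parity_adL p) (0, α)
  rw [coshSubOneDiv_neg, parity_apply, parity_apply, neg_zero, neg_apply] at h
  exact eq_zero_of_neg_eq_self 𝕜 (congrArg Prod.snd h).symm

variable {D}

/-! ### The domain -/

theorem AdExp_neg_sDouble (p : StrongDual 𝕜 D.l) :
    G.AdExp (-D.sDouble p) = expPrim 0 (-1 : 𝕜) (G.adL (D.sDouble p)) := by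
  rw [expPrim_zero_index, neg_one_smul, ← map_neg G.adL]; rfl

theorem mem_U_iff (p : StrongDual 𝕜 D.l) :
    p ∈ D.U ↔ IsUnit (sinhDiv (D.subLQB.adL (0, p))) ∧ IsUnit (D.adBlock p) := by
  rw [isUnit_sinhDiv_iff, ← zero_notMem_complexSpectrum_iff]; rfl

theorem contDiff_adL_sDouble : ContDiff 𝕜 ∞ fun p : StrongDual 𝕜 D.l => G.adL (D.sDouble p) := by
  exact contDiff_ad_comp G.adL D.sDouble

theorem contDiff_subLQB_adL :
    ContDiff 𝕜 ∞ fun p : StrongDual 𝕜 D.l => D.subLQB.adL (0, p) := by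
  exact contDiff_ad_comp D.subLQB.adL (ContinuousLinearMap.inr 𝕜 D.l (StrongDual 𝕜 D.l))

variable [CompleteSpace V]

theorem contDiff_AdExp : ContDiff 𝕜 ∞ fun p : StrongDual 𝕜 D.l => G.AdExp (-D.sDouble p) := by
  simp_rw [AdExp_neg_sDouble]
  exact (contDiff_expPrim 0).comp (contDiff_const.prodMk contDiff_adL_sDouble)

theorem contDiff_adBlock : ContDiff 𝕜 ∞ fun p : StrongDual 𝕜 D.l => D.adBlock p :=
  contDiff_const.clm_comp (contDiff_AdExp.clm_comp contDiff_const)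

theorem isOpen_U : IsOpen D.U := by
  rw [show D.U = _ from Set.ext mem_U_iff]
  exact (isOpen_setOf_isUnit (contDiff_sinhDiv.comp contDiff_subLQB_adL).continuous).inter
    (isOpen_setOf_isUnit contDiff_adBlock.continuous)

theorem contDiffOn_lcan : ContDiffOn 𝕜 ∞ D.lcan D.U := by
  have h1 : ContDiffOn 𝕜 ∞ D.rAM D.U := by
    refine contDiffOn_const.clm_comp (ContDiffOn.clm_comp ?_ contDiffOn_const)
    exact ((contDiff_coshSubSinhDivDiv.comp contDiff_subLQB_adL).contDiffOn).clm_comp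
      (contDiffOn_ringInverse_of_isUnit (contDiff_sinhDiv.comp contDiff_subLQB_adL).contDiffOn
        fun p hp => ((mem_U_iff p).1 hp).1)
  refine ContDiffOn.sub (contDiffOn_const.clm_comp (h1.clm_comp contDiffOn_const)) ?_
  exact (contDiffOn_ringInverse_of_isUnit contDiff_adBlock.contDiffOn
    fun p hp => ((mem_U_iff p).1 hp).2).clm_comp
    (contDiffOn_const.clm_comp (contDiff_AdExp.contDiffOn.clm_comp contDiffOn_const))

theorem contDiff_theta : ContDiff 𝕜 ∞ D.theta := by
  have h1 := contDiff_sinhSubDivSq.comp (contDiff_adL_sDouble (D := D))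
  have h2 := contDiff_sinhDiv.comp (contDiff_adL_sDouble (D := D))
  have h3 : ContDiff 𝕜 ∞ fun p => D.projL.comp
      ((ContinuousLinearMap.fst 𝕜 V (StrongDual 𝕜 V)).comp
      ((sinhSubDivSq (G.adL (D.sDouble p))).comp D.sDouble)) :=
    contDiff_const.clm_comp (contDiff_const.clm_comp (h1.clm_comp contDiff_const))
  have h4 : ContDiff 𝕜 ∞ fun p => (ContinuousLinearMap.snd 𝕜 V (StrongDual 𝕜 V)).comp
      ((sinhDiv (G.adL (D.sDouble p))).comp D.sDouble) :=
    contDiff_const.clm_comp (h2.clm_comp contDiff_const)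
  have h5 := ((contDiff_const (c := ContinuousLinearMap.inl 𝕜 D.l (StrongDual 𝕜 V))).clm_comp
    h3).add ((contDiff_const (c := ContinuousLinearMap.inr 𝕜 D.l (StrongDual 𝕜 V))).clm_comp h4)
  convert! h5 using 1
  funext p
  ext α : 1
  exact Prod.ext (add_zero _).symm (zero_add _).symm

/-! ### The values of `θ` and of the `ℓ`-matrix -/

variable (hG : G.IsLieQuasiBialgebra) (hD : D.IsCanonicallyCompatible)

include hD

theorem sinhSubDivSq_sDouble (p α : StrongDual 𝕜 D.l) :
    sinhSubDivSq (G.adL (D.sDouble p)) (D.sDouble α) = (((D.theta p α).1 : V), 0) := by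
  have h := sinhSubDivSq_intertwine
    (fun X => (adL_sDouble_kappa hD p X).symm) ((0, α) : D.l × StrongDual 𝕜 D.l)
  rw [kappa_inr] at h
  have h1 : (D.theta p α).1 = D.projL (sinhSubDivSq (G.adL (D.sDouble p)) (D.sDouble α)).1 := rfl
  rw [h1, ← h, kappa_apply, sinhSubDivSq_adL_inr, projL_coe, map_zero]

theorem sinhDiv_sDouble (p α : StrongDual 𝕜 D.l) :
    sinhDiv (G.adL (D.sDouble p)) (D.sDouble α)
      = D.sDouble (sinhDiv (D.subLQB.adL (0, p)) (0, α)).2 := by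
  have h := sinhDiv_intertwine
    (fun X => (adL_sDouble_kappa hD p X).symm) ((0, α) : D.l × StrongDual 𝕜 D.l)
  rw [kappa_inr] at h
  rw [← h, kappa_apply, sinhDiv_adL_inr]; rfl

theorem theta_snd (p α : StrongDual 𝕜 D.l) :
    (D.theta p α).2 = D.s (sinhDiv (D.subLQB.adL (0, p)) (0, α)).2 :=
  congrArg Prod.snd (sinhDiv_sDouble hD p α)

theorem sinhDiv_sDouble_eq_theta (p α : StrongDual 𝕜 D.l) :
    sinhDiv (G.adL (D.sDouble p)) (D.sDouble α) = (0, (D.theta p α).2) := by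
  rw [theta_snd hD, sinhDiv_sDouble hD]; rfl

theorem sinhDiv_coe (p : StrongDual 𝕜 D.l) (z : D.l) :
    sinhDiv (G.adL (D.sDouble p)) ((z : V), 0)
      = (((sinhDiv (D.subLQB.adL (0, p)) (z, 0)).1 : V), 0) := by
  have h := sinhDiv_intertwine
    (fun X => (adL_sDouble_kappa hD p X).symm) ((z, 0) : D.l × StrongDual 𝕜 D.l)
  rw [kappa_apply, kappa_apply, sinhDiv_adL_inl, map_zero] at h
  exact h.symm

theorem coshSubOneDiv_sDouble (p α : StrongDual 𝕜 D.l) :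
    coshSubOneDiv (G.adL (D.sDouble p)) (D.sDouble α)
      = (((coshSubOneDiv (D.subLQB.adL (0, p)) (0, α)).1 : V), 0) := by
  have h := coshSubOneDiv_intertwine
    (fun X => (adL_sDouble_kappa hD p X).symm) ((0, α) : D.l × StrongDual 𝕜 D.l)
  rw [kappa_inr] at h
  rw [← h, kappa_apply, coshSubOneDiv_adL_inr, map_zero]

omit hD [CompleteSpace V] in
-- The even operator sinh A / A preserves 𝔩*, and on U it is invertible; so it is onto there.
theorem exists_sinhDiv_snd_eq {p : StrongDual 𝕜 D.l} (hp : p ∈ D.U) (β : StrongDual 𝕜 D.l) :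
    ∃ α, (sinhDiv (D.subLQB.adL (0, p)) (0, α)).2 = β := by
  obtain ⟨⟨z, α⟩, hx, hy⟩ := exists_mem_apply_eq_of_isUnit ((mem_U_iff p).1 hp).1
    (W := (⊥ : Submodule 𝕜 D.l).prod ⊤) (y := (0, β)) (fun X hX => by
      obtain ⟨z, α⟩ := X
      obtain rfl : z = 0 := hX.1
      exact ⟨D.sinhDiv_adL_inr p α, trivial⟩) ⟨rfl, trivial⟩
  obtain rfl : z = 0 := hx.1
  exact ⟨α, by rw [hy]⟩

omit hD [CompleteSpace V] in
theorem exists_sinhDiv_fst_eq {p : StrongDual 𝕜 D.l} (hp : p ∈ D.U) (w : D.l) :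
    ∃ z, (sinhDiv (D.subLQB.adL (0, p)) (z, 0)).1 = w := by
  obtain ⟨⟨z, α⟩, hx, hy⟩ := exists_mem_apply_eq_of_isUnit ((mem_U_iff p).1 hp).1
    (W := (⊤ : Submodule 𝕜 D.l).prod ⊥) (y := (w, 0)) (fun X hX => by
      obtain ⟨z, α⟩ := X
      obtain rfl : α = 0 := hX.2
      exact ⟨trivial, D.sinhDiv_adL_inl p z⟩) ⟨trivial, rfl⟩
  obtain rfl : α = 0 := hx.2
  exact ⟨z, by rw [hy]⟩

omit hD [CompleteSpace V] in
theorem lcan_s (p β : StrongDual 𝕜 D.l) : D.lcan p (D.s β) = D.rAM p β := by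
  simp [lcan, restr_s]

/-- The `ℓ`-matrix maps `(sinh A / A) α` to `((cosh A - 1) / A - (sinh A - A) / A²) α`. -/
theorem lcan_theta_snd {p : StrongDual 𝕜 D.l} (hp : p ∈ D.U) (α : StrongDual 𝕜 D.l) :
    (D.lcan p (D.theta p α).2, (0 : StrongDual 𝕜 V))
      = coshSubOneDiv (G.adL (D.sDouble p)) (D.sDouble α) - (((D.theta p α).1 : V), 0) := by
  have h0 : ((0, (sinhDiv (D.subLQB.adL (0, p)) (0, α)).2) : D.l × StrongDual 𝕜 D.l)
      = sinhDiv (D.subLQB.adL (0, p)) (0, α) := by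
    ext1
    · exact (D.sinhDiv_adL_inr p α).symm
    · rfl
  have h1 : D.rAM p (sinhDiv (D.subLQB.adL (0, p)) (0, α)).2
      = (coshSubSinhDivDiv (D.subLQB.adL (0, p)) (0, α)).1 := by
    change (coshSubSinhDivDiv (D.subLQB.adL (0, p))
      (Ring.inverse (sinhDiv (D.subLQB.adL (0, p)))
        (0, (sinhDiv (D.subLQB.adL (0, p)) (0, α)).2))).1 = _
    rw [h0, Ring.inverse_apply_apply ((mem_U_iff p).1 hp).1]
  have h2 := sinhSubDivSq_intertwine
    (fun X => (adL_sDouble_kappa hD p X).symm) ((0, α) : D.l × StrongDual 𝕜 D.l)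
  rw [kappa_inr, sinhSubDivSq_sDouble hD] at h2
  rw [theta_snd hD, lcan_s, h1, coshSubSinhDivDiv_eq, coshSubOneDiv_sDouble hD]
  have h3 : ((sinhSubDivSq (D.subLQB.adL (0, p)) (0, α)).1 : V) = (D.theta p α).1 :=
    congrArg Prod.fst h2
  rw [← h3]
  ext1 <;> simp

include hG

theorem expPrim_mem_mPerp (p : StrongDual 𝕜 D.l) (t : 𝕜) {X : V × StrongDual 𝕜 V}
    (hX : X ∈ D.mPerp) : expPrim 0 t (G.adL (D.sDouble p)) X ∈ D.mPerp := by
  rw [expPrim, pow_zero, one_smul]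
  exact expTail_mem (fun Y hY => D.mPerp.smul_mem t (adL_sDouble_mem_mPerp hG hD p hY)) 0 hX

/-- On 𝔩^⊥ the ℓ-matrix is defined by killing the 𝔤-component of e^{-A}(l_p ξ + ξ). It takes values
in 𝔪 because e^{-A} preserves 𝔪 ⊕ 𝔩^⊥, and hence the invertible block preserves 𝔪. -/
theorem lcan_perp {p : StrongDual 𝕜 D.l} (hp : p ∈ D.U) {ξ : StrongDual 𝕜 V}
    (hξ : D.restr ξ = 0) :
    D.lcan p ξ ∈ D.m ∧ (expPrim 0 (-1 : 𝕜) (G.adL (D.sDouble p)) (D.lcan p ξ, ξ)).1 = 0 := by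
  have hu := ((mem_U_iff p).1 hp).2
  have h1 : D.lcan p ξ = -Ring.inverse (D.adBlock p)
      (expPrim 0 (-1 : 𝕜) (G.adL (D.sDouble p)) (0, ξ)).1 := by
    rw [← AdExp_neg_sDouble]
    have h0 : G.AdExp (-D.sDouble p) (0, 0) = 0 := map_zero (G.AdExp (-D.sDouble p))
    simp [lcan, hξ, h0]
  have hB : ∀ x, D.adBlock p x = (expPrim 0 (-1 : 𝕜) (G.adL (D.sDouble p)) (x, 0)).1 := by
    intro x
    rw [← AdExp_neg_sDouble]; rfl
  have hBm : ∀ x ∈ D.m, D.adBlock p x ∈ D.m := by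
    intro x hx
    rw [hB]
    exact (expPrim_mem_mPerp hG hD p (-1) (X := (x, 0)) ⟨hx, map_zero _⟩).1
  constructor
  · obtain ⟨x, hx, hxy⟩ := exists_mem_apply_eq_of_isUnit hu hBm
      (expPrim_mem_mPerp hG hD p (-1) (X := (0, ξ)) ⟨D.m.zero_mem, hξ⟩).1
    rw [h1, ← hxy, Ring.inverse_apply_apply hu]
    exact D.m.neg_mem hx
  · rw [show (D.lcan p ξ, ξ) = (D.lcan p ξ, 0) + (0, ξ) by simp, map_add, Prod.fst_add, ← hB, h1,
      map_neg, Ring.apply_inverse_apply hu]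
    simp

end ReductiveDecomposition

namespace ReductiveDecomposition

open LQBData

variable {𝕜 : Type*} [RCLike 𝕜] {V : Type*} [NormedAddCommGroup V] [NormedSpace 𝕜 V]
  [FiniteDimensional 𝕜 V] {G : LQBData 𝕜 V} {D : ReductiveDecomposition G} [CompleteSpace V]

/-! ### The isomorphism `φ_p` -/

omit [FiniteDimensional 𝕜 V] [CompleteSpace V] in
theorem twistMap_apply (t : StrongDual 𝕜 V →L[𝕜] V) (X : V × StrongDual 𝕜 V) :
    twistMap t X = (X.1 + t X.2, X.2) := rfl

omit [FiniteDimensional 𝕜 V] [CompleteSpace V] in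
theorem isUnit_twistMap (t : StrongDual 𝕜 V →L[𝕜] V) : IsUnit (twistMap t) := by
  refine isUnit_iff_exists.2 ⟨twistMap (-t), ?_, ?_⟩ <;>
  · refine ContinuousLinearMap.ext fun X => ?_
    rw [mul_apply_eq_comp, twistMap_apply, twistMap_apply]
    simp

theorem isUnit_expPrim_zero {R : Type*} [NormedRing R] [NormedAlgebra 𝕜 R] [CompleteSpace R]
    (t : 𝕜) (a : R) : IsUnit (expPrim 0 t a) := by
  refine isUnit_iff_exists.2 ⟨expPrim 0 (-t) a, ?_, expPrim_zero_neg_mul t a⟩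
  simpa using expPrim_zero_neg_mul (-t) a

theorem expPrim_zero_neg_one_apply_one {E : Type*} [NormedAddCommGroup E] [NormedSpace 𝕜 E]
    [CompleteSpace E] (A : E →L[𝕜] E) (x : E) :
    expPrim 0 (-1 : 𝕜) A (expPrim 0 (1 : 𝕜) A x) = x := by
  rw [← mul_apply_eq_comp, expPrim_zero_neg_mul]; rfl

theorem expPrim_zero_one_apply_neg_one {E : Type*} [NormedAddCommGroup E] [NormedSpace 𝕜 E]
    [CompleteSpace E] (A : E →L[𝕜] E) (x : E) :
    expPrim 0 (1 : 𝕜) A (expPrim 0 (-1 : 𝕜) A x) = x := by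
  have h := expPrim_zero_neg_mul (-1 : 𝕜) A
  rw [neg_neg] at h
  rw [← mul_apply_eq_comp, h]; rfl

omit [CompleteSpace V] in
theorem phi_eq (p : StrongDual 𝕜 D.l) :
    D.phi p = expPrim 0 (-1 : 𝕜) (G.adL (D.sDouble p)) * twistMap (D.lcan p) := by
  rw [phi, AdExp_neg_sDouble]; rfl

omit [CompleteSpace V] in
theorem phi_apply (p : StrongDual 𝕜 D.l) (X : V × StrongDual 𝕜 V) :
    D.phi p X = expPrim 0 (-1 : 𝕜) (G.adL (D.sDouble p)) (X.1 + D.lcan p X.2, X.2) := by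
  rw [phi_eq]; rfl

theorem isUnit_phi (p : StrongDual 𝕜 D.l) : IsUnit (D.phi p) := by
  rw [phi_eq]
  exact (isUnit_expPrim_zero _ _).mul (isUnit_twistMap _)

/-- The scalar identity is sinh z / z + sinh z + (cosh z - 1) - (sinh z / z - 1) = e^z. -/
theorem sinhDiv_add_exp {E : Type*} [NormedAddCommGroup E] [NormedSpace 𝕜 E] [CompleteSpace E]
    (A : E →L[𝕜] E) (x : E) :
    sinhDiv A x + sinhDiv A (A x) + coshSubOneDiv A (A x) - sinhSubDivSq A (A x)
      = expPrim 0 (1 : 𝕜) A x := by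
  have h1 : sinhDiv A (A x) + coshSubOneDiv A (A x) = expPrim 0 (1 : 𝕜) A x - x := by
    rw [← add_apply, sinhDiv_add_coshSubOneDiv, ← expTail_intertwine (K := A) (fun _ => rfl),
      ← mul_apply_eq_comp, ← expPrim_one_one, mul_expPrim_one]
    rfl
  have h2 : sinhSubDivSq A (A x) = sinhDiv A x - x := by
    rw [← sinhSubDivSq_intertwine (K := A) (fun _ => rfl), ← mul_apply_eq_comp, mul_sinhSubDivSq]
    rfl
  rw [add_assoc, h1, h2]; abel

variable (hG : G.IsLieQuasiBialgebra) (hD : D.IsCanonicallyCompatible)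

include hD in
-- With y = (sinh A / A) z and α = ad*_z p, that is sα = A z, the 𝔤*-entry is (sinh A / A) sα,
-- because A commutes with its functions. The ℓ-matrix is known on such elements, and the twisted
-- vector is e^A z.
theorem phi_sinhDiv {p : StrongDual 𝕜 D.l} (hp : p ∈ D.U) (z : D.l) :
    D.phi p (((sinhDiv (D.subLQB.adL (0, p)) (z, 0)).1 : V),
      D.s (D.subLQB.adStar (sinhDiv (D.subLQB.adL (0, p)) (z, 0)).1 p)) = ((z : V), 0) := by
  set A := G.adL (D.sDouble p)
  set y := (sinhDiv (D.subLQB.adL (0, p)) (z, 0)).1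
  set α := D.subLQB.adStar z p
  have h1 : A ((z : V), 0) = D.sDouble α := adL_sDouble_coe hD p z
  have h2 : sinhDiv A ((z : V), 0) = ((y : V), 0) := sinhDiv_coe hD p z
  have h3 : D.s (D.subLQB.adStar y p) = (D.theta p α).2 := by
    have h4 : A (sinhDiv A ((z : V), 0)) = sinhDiv A (A ((z : V), 0)) :=
      sinhDiv_intertwine (K := A) (fun _ => rfl) _
    rw [h1, h2, sinhDiv_sDouble_eq_theta hD, adL_sDouble_coe hD p y] at h4
    exact congrArg Prod.snd h4
  have h5 : (((y : V) + D.lcan p (D.theta p α).2, (D.theta p α).2) : V × StrongDual 𝕜 V)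
      = sinhDiv A ((z : V), 0) + sinhDiv A (A ((z : V), 0)) + coshSubOneDiv A (A ((z : V), 0))
        - sinhSubDivSq A (A ((z : V), 0)) := by
    rw [h1, h2, sinhDiv_sDouble_eq_theta hD, sinhSubDivSq_sDouble hD, add_sub_assoc,
      ← lcan_theta_snd hD hp]
    simp
  rw [h3, phi_apply, h5, sinhDiv_add_exp, expPrim_zero_neg_one_apply_one]

include hG hD in
theorem phi_perp {p : StrongDual 𝕜 D.l} (hp : p ∈ D.U) {ξ : StrongDual 𝕜 V}
    (hξ : D.restr ξ = 0) : ∃ ξ', D.restr ξ' = 0 ∧ D.phi p (0, ξ) = (0, ξ') := by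
  obtain ⟨h1, h2⟩ := lcan_perp hG hD hp hξ
  have h3 := expPrim_mem_mPerp hG hD p (-1) (X := (D.lcan p ξ, ξ)) ⟨h1, hξ⟩
  refine ⟨_, h3.2, ?_⟩
  rw [phi_apply, zero_add]
  exact Prod.ext h2 rfl

include hG hD in
theorem exists_phi_perp_eq {p : StrongDual 𝕜 D.l} (hp : p ∈ D.U) {ξ' : StrongDual 𝕜 V}
    (hξ : D.restr ξ' = 0) : ∃ ξ, D.restr ξ = 0 ∧ D.phi p (0, ξ) = (0, ξ') := by
  obtain ⟨⟨x, ξ⟩, hx, hy⟩ := exists_mem_apply_eq_of_isUnit (isUnit_phi p)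
    (W := (⊥ : Submodule 𝕜 V).prod
      (LinearMap.ker (D.restr : StrongDual 𝕜 V →ₗ[𝕜] StrongDual 𝕜 D.l))) (y := (0, ξ'))
    (fun X hX => by
      obtain ⟨x, ξ⟩ := X
      obtain rfl : x = 0 := hX.1
      obtain ⟨ξ', h1, h2⟩ := phi_perp hG hD hp (ξ := ξ) hX.2
      rw [h2]
      exact ⟨rfl, h1⟩) ⟨rfl, hξ⟩
  obtain rfl : x = 0 := hx.1
  exact ⟨ξ, hx.2, hy⟩

omit [FiniteDimensional 𝕜 V] [CompleteSpace V] in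
theorem incl_apply (σ : D.l × StrongDual 𝕜 V) : D.incl σ = ((σ.1 : V), σ.2) := rfl

include hG hD in
theorem exists_phi_incl_eq {p : StrongDual 𝕜 D.l} (hp : p ∈ D.U) (z : D.l) {ξ : StrongDual 𝕜 V}
    (hξ : D.restr ξ = 0) : ∃ σ : D.l × StrongDual 𝕜 V, D.restr σ.2 = D.subLQB.adStar σ.1 p ∧
      D.phi p (D.incl σ) = ((z : V), ξ) ∧ σ.1 = (sinhDiv (D.subLQB.adL (0, p)) (z, 0)).1 := by
  obtain ⟨η, hη, hη'⟩ := exists_phi_perp_eq hG hD hp hξ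
  -- The preimage of z is the explicit one of `phi_sinhDiv`; the preimage of ξ lies in 𝔩^⊥ and does
  -- not affect the 𝔩-entry.
  refine ⟨((sinhDiv (D.subLQB.adL (0, p)) (z, 0)).1,
    D.s (D.subLQB.adStar (sinhDiv (D.subLQB.adL (0, p)) (z, 0)).1 p) + η), ?_, ?_, rfl⟩
  · rw [map_add, hη, restr_s, add_zero]
  · have h : D.incl ((sinhDiv (D.subLQB.adL (0, p)) (z, 0)).1,
        D.s (D.subLQB.adStar (sinhDiv (D.subLQB.adL (0, p)) (z, 0)).1 p) + η)
        = (((sinhDiv (D.subLQB.adL (0, p)) (z, 0)).1 : V),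
          D.s (D.subLQB.adStar (sinhDiv (D.subLQB.adL (0, p)) (z, 0)).1 p)) + (0, η) := by
      simp [incl_apply]
    rw [h, map_add, phi_sinhDiv hD hp, hη']
    simp

omit [FiniteDimensional 𝕜 V] [CompleteSpace V] in
theorem mem_gStar_zero [FiniteDimensional 𝕜 V] {X : V × StrongDual 𝕜 V} :
    X ∈ D.gStar 0 ↔ ∃ z : D.l, (z : V) = X.1 ∧ D.restr X.2 = 0 := by
  constructor
  · rintro ⟨σ, h, rfl⟩
    exact ⟨σ.1, rfl, h.trans (by ext; simp [adStar])⟩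
  · rintro ⟨z, h, h'⟩
    exact ⟨(z, X.2), h'.trans (by ext; simp [adStar]), Prod.ext h rfl⟩

include hG hD in
theorem bijOn_phi {p : StrongDual 𝕜 D.l} (hp : p ∈ D.U) :
    Set.BijOn (D.phi p) (D.gStar p) (D.gStar 0) := by
  refine ⟨?_, ?_, ?_⟩
  · rintro _ ⟨σ, hσ, rfl⟩
    obtain ⟨z, hz⟩ := exists_sinhDiv_fst_eq hp σ.1
    obtain ⟨ξ', h1, h2⟩ := phi_perp hG hD hp (ξ := σ.2 - D.s (D.restr σ.2))
      (by rw [map_sub, restr_s, sub_self])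
    have h : D.incl σ = (((sinhDiv (D.subLQB.adL (0, p)) (z, 0)).1 : V),
          D.s (D.subLQB.adStar (sinhDiv (D.subLQB.adL (0, p)) (z, 0)).1 p))
          + (0, σ.2 - D.s (D.restr σ.2)) := by
      rw [hz, ← hσ, incl_apply]
      simp
    rw [h, map_add, phi_sinhDiv hD hp, h2]
    exact mem_gStar_zero.2 ⟨z, by simp, by simpa using h1⟩
  · intro X _ Y _ hXY
    rw [← Ring.inverse_apply_apply (isUnit_phi p) X, hXY, Ring.inverse_apply_apply (isUnit_phi p)]
  · intro X hX
    obtain ⟨z, hz, hξ⟩ := mem_gStar_zero.1 hX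
    obtain ⟨σ, h1, h2, -⟩ := exists_phi_incl_eq hG hD hp z hξ
    exact ⟨D.incl σ, ⟨σ, h1, rfl⟩, h2.trans (Prod.ext hz rfl)⟩

omit [CompleteSpace V] in
theorem proj_incl (σ : D.l × StrongDual 𝕜 V) : D.proj (D.incl σ) = σ :=
  Prod.ext (D.projL_coe σ.1) rfl

include hG hD in
-- The last clause makes the 𝔩-entry of ψ explicit and independent of ξ, which allows it to be
-- differentiated without differentiating an inverse.
theorem psi_spec {p : StrongDual 𝕜 D.l} (hp : p ∈ D.U) (z : D.l) {ξ : StrongDual 𝕜 V}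
    (hξ : D.restr ξ = 0) : D.restr (D.psi p ((z : V), ξ)).2
        = D.subLQB.adStar (D.psi p ((z : V), ξ)).1 p ∧
      D.phi p (D.incl (D.psi p ((z : V), ξ))) = -((z : V), ξ) ∧
      (D.psi p ((z : V), ξ)).1 = -(sinhDiv (D.subLQB.adL (0, p)) (z, 0)).1 := by
  obtain ⟨σ, h1, h2, h3⟩ := exists_phi_incl_eq hG hD hp z hξ
  have h : D.psi p ((z : V), ξ) = -σ := by
    rw [← h2]
    change -(D.proj (Ring.inverse (D.phi p) (D.phi p (D.incl σ)))) = -σ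
    rw [Ring.inverse_apply_apply (isUnit_phi p), proj_incl]
  rw [h]
  refine ⟨?_, ?_, ?_⟩
  · rw [Prod.snd_neg, Prod.fst_neg, map_neg, h1]
    ext; simp [adStar]
  · rw [map_neg, map_neg, h2]
  · rw [Prod.fst_neg, h3]

include hD in
-- Apply A · (sinh A - A)/A² = sinh A / A - 1 to sα: on 𝔩, A is z ↦ s(ad*_z p), so the two entries
-- of θ differ under the anchor exactly by α.
theorem anchor_theta (p α : StrongDual 𝕜 D.l) : D.anchor p (D.theta p α) = α := by
  have h : G.adL (D.sDouble p) (((D.theta p α).1 : V), 0)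
      = (0, (D.theta p α).2) - D.sDouble α := by
    rw [← sinhSubDivSq_sDouble hD, ← sinhDiv_sDouble_eq_theta hD, ← mul_apply_eq_comp,
      mul_sinhSubDivSq]
    rfl
  rw [adL_sDouble_coe hD] at h
  have h2 := congrArg (fun X => D.restr X.2) h
  simp only [Prod.snd_sub, sDouble_apply, map_sub, restr_s] at h2
  rw [anchor, h2]
  abel

theorem contDiffOn_psi : ContDiffOn 𝕜 ∞ D.psi D.U := by
  have h1 : ContDiffOn 𝕜 ∞ (fun p => twistMap (D.lcan p)) D.U := by
    have h2 : ∀ t : StrongDual 𝕜 V →L[𝕜] V, twistMap t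
        = (ContinuousLinearMap.id 𝕜 (V × StrongDual 𝕜 V))
          + (ContinuousLinearMap.inl 𝕜 V (StrongDual 𝕜 V)).comp
            (t.comp (ContinuousLinearMap.snd 𝕜 V (StrongDual 𝕜 V))) := by
      intro t
      refine ContinuousLinearMap.ext fun X => ?_
      rw [twistMap_apply]
      exact Prod.ext rfl (add_zero _).symm
    simp_rw [h2]
    exact contDiffOn_const.add
      (contDiffOn_const.clm_comp (contDiffOn_lcan.clm_comp contDiffOn_const))
  have h3 : ContDiffOn 𝕜 ∞ D.phi D.U := contDiff_AdExp.contDiffOn.clm_comp h1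
  exact (contDiffOn_const.clm_comp
    (contDiffOn_ringInverse_of_isUnit h3 fun p _ => isUnit_phi p)).neg

end ReductiveDecomposition

/-! ### Adjoints of even and odd functions of a skew operator -/

section Adjoint

variable {𝕜 : Type*} [RCLike 𝕜] {E P : Type*} [NormedAddCommGroup E] [NormedSpace 𝕜 E]
  [NormedAddCommGroup P] [NormedSpace 𝕜 P] {B : E →L[𝕜] E →L[𝕜] 𝕜}

theorem fderiv_skew_adjoint {f g : P → E →L[𝕜] E} {p : P} (hf : DifferentiableAt 𝕜 f p)
    (hg : DifferentiableAt 𝕜 g p) {x x' y y' : E} (h : ∀ q, B (f q x) y = -B (g q x') y') (v : P) :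
    B (fderiv 𝕜 f p v x) y = -B (fderiv 𝕜 g p v x') y' := by
  have h1 := (B.flip y).hasFDerivAt.comp p (hf.hasFDerivAt.clm_apply (hasFDerivAt_const x p))
  have h2 :=
    ((B.flip y').hasFDerivAt.comp p (hg.hasFDerivAt.clm_apply (hasFDerivAt_const x' p))).neg
  have he : (B.flip y ∘ fun q => f q x) = -(B.flip y' ∘ fun q => g q x') := funext h
  rw [he] at h1
  simpa using congrArg (fun L => L v) (h1.unique h2)

theorem fderiv_apply_const {f : P → E →L[𝕜] E} {p : P} (hf : DifferentiableAt 𝕜 f p) (x : E)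
    (v : P) : fderiv 𝕜 (fun q => f q x) p v = fderiv 𝕜 f p v x := by
  have h := (hf.hasFDerivAt.clm_apply (hasFDerivAt_const x p)).fderiv
  rw [h]; simp

variable [CompleteSpace E] {A : E →L[𝕜] E}

theorem sinhDiv_adjoint (hA : ∀ x y, B (A x) y = -B x (A y)) (x y : E) :
    B (sinhDiv A x) y = B x (sinhDiv A y) := by
  have h1 : ∀ x y, B (A x) y = B x ((-A) y) := fun x y => by simp [hA]
  have h2 : ∀ x y, B ((-A) x) y = B x (A y) := fun x y => by simp [hA]
  simp only [sinhDiv_eq, smul_apply, add_apply, map_smul, map_add, expTail_adjoint h1,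
    expTail_adjoint h2]
  rw [add_comm]

theorem sinhSubDivSq_adjoint (hA : ∀ x y, B (A x) y = -B x (A y)) (x y : E) :
    B (sinhSubDivSq A x) y = -B x (sinhSubDivSq A y) := by
  have h1 : ∀ x y, B (A x) y = B x ((-A) y) := fun x y => by simp [hA]
  have h2 : ∀ x y, B ((-A) x) y = B x (A y) := fun x y => by simp [hA]
  simp only [sinhSubDivSq_eq, smul_apply, sub_apply, map_smul, map_sub, expTail_adjoint h1,
    expTail_adjoint h2, smul_eq_mul]
  ring

theorem coshSubOneDiv_adjoint (hA : ∀ x y, B (A x) y = -B x (A y)) (x y : E) :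
    B (coshSubOneDiv A x) y = -B x (coshSubOneDiv A y) := by
  have h1 : ∀ x y, B (A x) y = B x ((-A) y) := fun x y => by simp [hA]
  have h2 : ∀ x y, B ((-A) x) y = B x (A y) := fun x y => by simp [hA]
  simp only [coshSubOneDiv, smul_apply, sub_apply, map_smul, map_sub, expTail_adjoint h1,
    expTail_adjoint h2, smul_eq_mul]
  ring

theorem form_sinhDiv_coshSubOneDiv (hA : ∀ x y, B (A x) y = -B x (A y)) (x y : E) :
    B (sinhDiv A x) (coshSubOneDiv A y) = -B (coshSubOneDiv A x) (sinhDiv A y) := by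
  rw [sinhDiv_adjoint hA, coshSubOneDiv_adjoint hA, neg_neg,
    sinhDiv_intertwine (K := coshSubOneDiv A)
      fun x => (coshSubOneDiv_intertwine (K := A) (fun _ => rfl) x).symm]

theorem form_sinhDiv_sinhSubDivSq (hA : ∀ x y, B (A x) y = -B x (A y)) (x y : E) :
    B (sinhDiv A x) (sinhSubDivSq A y) = -B (sinhSubDivSq A x) (sinhDiv A y) := by
  rw [sinhDiv_adjoint hA, sinhSubDivSq_adjoint hA, neg_neg,
    sinhDiv_intertwine (K := sinhSubDivSq A)
      fun x => (sinhSubDivSq_intertwine (K := A) (fun _ => rfl) x).symm]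

end Adjoint

namespace ReductiveDecomposition

open LQBData

variable {𝕜 : Type*} [RCLike 𝕜] {V : Type*} [NormedAddCommGroup V] [NormedSpace 𝕜 V]
  [FiniteDimensional 𝕜 V] {G : LQBData 𝕜 V} {D : ReductiveDecomposition G} [CompleteSpace V]
  (hG : G.IsLieQuasiBialgebra) (hD : D.IsCanonicallyCompatible)

/-! ### The image of `θ` in the double -/

include hD in
-- By `lcan_theta_snd`, l_p contributes (cosh A - 1)/A minus the first entry of θ. What remains is
-- sinh A / A + (cosh A - 1)/A = (e^A - 1)/A.
theorem twist_theta {p : StrongDual 𝕜 D.l} (hp : p ∈ D.U) (α : StrongDual 𝕜 D.l) :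
    ((((D.theta p α).1 : V) + D.lcan p (D.theta p α).2, (D.theta p α).2) : V × StrongDual 𝕜 V)
      = expTail 𝕜 1 (G.adL (D.sDouble p)) (D.sDouble α) := by
  rw [← sinhDiv_add_coshSubOneDiv, add_apply, sinhDiv_sDouble_eq_theta hD,
    sub_eq_iff_eq_add'.1 (lcan_theta_snd hD hp α).symm]
  simp

include hG hD

/-- The even part of (e^A - 1)/A sends s𝔩* to 𝔤* and the odd part sends it to 𝔤, both isotropic; the
cross terms cancel since the even part is self-adjoint and the odd part skew. -/
theorem form_expTail_sDouble (p α β : StrongDual 𝕜 D.l) :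
    form 𝕜 V (expTail 𝕜 1 (G.adL (D.sDouble p)) (D.sDouble α))
      (expTail 𝕜 1 (G.adL (D.sDouble p)) (D.sDouble β)) = 0 := by
  have h := form_sinhDiv_coshSubOneDiv (B := form 𝕜 V) (hG.form_adL (D.sDouble p))
    (D.sDouble α) (D.sDouble β)
  have h1 : form 𝕜 V (sinhDiv (G.adL (D.sDouble p)) (D.sDouble α))
      (sinhDiv (G.adL (D.sDouble p)) (D.sDouble β)) = 0 := by
    rw [sinhDiv_sDouble_eq_theta hD, sinhDiv_sDouble_eq_theta hD, form_apply]; simp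
  have h2 : form 𝕜 V (coshSubOneDiv (G.adL (D.sDouble p)) (D.sDouble α))
      (coshSubOneDiv (G.adL (D.sDouble p)) (D.sDouble β)) = 0 := by
    rw [coshSubOneDiv_sDouble hD, coshSubOneDiv_sDouble hD, form_apply]; simp
  rw [← sinhDiv_add_coshSubOneDiv]
  simp only [add_apply, map_add]
  rw [h1, h2, h]
  ring

/-- Split η along s𝔩* ⊕ 𝔩^⊥. The 𝔩^⊥ part contributes nothing, because l_p sends 𝔩^⊥ to 𝔪 and s𝔩* to
𝔩. On s𝔩* the skewness is that of odd functions of A. -/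
theorem lcan_skew {p : StrongDual 𝕜 D.l} (hp : p ∈ D.U) (α : StrongDual 𝕜 D.l)
    (η : StrongDual 𝕜 V) :
    (D.theta p α).2 (D.lcan p η) = -η (D.lcan p (D.theta p α).2) := by
  obtain ⟨β, hβ⟩ := exists_sinhDiv_snd_eq hp (D.restr η)
  have hβ' : D.s (D.restr η) = (D.theta p β).2 := by rw [theta_snd hD, hβ]
  set η₀ := η - D.s (D.restr η) with hη₀
  have h0 : D.restr η₀ = 0 := by rw [hη₀, map_sub, restr_s, sub_self]
  have h1 : η = (D.theta p β).2 + η₀ := by rw [hη₀, ← hβ']; abel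
  have h2 : (D.theta p α).2 (D.lcan p η₀) = 0 := by
    rw [theta_snd hD]
    exact D.s_apply_of_mem_m _ (lcan_perp hG hD hp h0).1
  have hl := fun α => lcan_theta_snd hD hp α
  have h3 : η₀ (D.lcan p (D.theta p α).2) = 0 := by
    have h4 := congrArg Prod.fst (hl α)
    rw [coshSubOneDiv_sDouble hD] at h4
    have h5 : D.lcan p (D.theta p α).2 ∈ D.l := by
      rw [show D.lcan p (D.theta p α).2 = _ from h4]
      exact D.l.sub_mem (Subtype.mem _) (Subtype.mem _)
    exact (D.restr_eq_zero_iff _).1 h0 _ h5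
  have h6 : form 𝕜 V (sinhDiv (G.adL (D.sDouble p)) (D.sDouble α))
        (coshSubOneDiv (G.adL (D.sDouble p)) (D.sDouble β) - (((D.theta p β).1 : V), 0))
      = -form 𝕜 V (coshSubOneDiv (G.adL (D.sDouble p)) (D.sDouble α) - (((D.theta p α).1 : V), 0))
        (sinhDiv (G.adL (D.sDouble p)) (D.sDouble β)) := by
    have h7 := form_sinhDiv_coshSubOneDiv (B := form 𝕜 V) (hG.form_adL (D.sDouble p))
      (D.sDouble α) (D.sDouble β)
    have h8 := form_sinhDiv_sinhSubDivSq (B := form 𝕜 V) (hG.form_adL (D.sDouble p))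
      (D.sDouble α) (D.sDouble β)
    rw [← sinhSubDivSq_sDouble hD, ← sinhSubDivSq_sDouble hD]
    simp only [map_sub, sub_apply]
    rw [h7, h8]
    ring
  rw [← hl, ← hl, sinhDiv_sDouble_eq_theta hD, sinhDiv_sDouble_eq_theta hD, form_apply,
    form_apply] at h6
  simp only [map_zero, add_zero, zero_add] at h6
  rw [h1, map_add, map_add, add_apply, h2, h3, h6]
  ring

/-! ### The bracket of `N(U)` with a section `θ α` -/

/-- The `𝔩`-component of the bracket of `θ α` with a section of constant anchor, in terms of the
images of the sections in the double. -/
theorem bracketN_theta_fst {p : StrongDual 𝕜 D.l} (hp : p ∈ D.U)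
    {σ : StrongDual 𝕜 D.l → D.l × StrongDual 𝕜 V} (hσ : DifferentiableAt 𝕜 σ p)
    {v : StrongDual 𝕜 D.l} (hv : ∀ q ∈ D.U, D.anchor q (σ q) = v)
    {X : StrongDual 𝕜 D.l → V × StrongDual 𝕜 V}
    (hX : ∀ q ∈ D.U, X q = (((σ q).1 : V) + D.lcan q (σ q).2, (σ q).2))
    (α γ : StrongDual 𝕜 D.l) :
    γ (D.bracketN D.lcan (fun q => D.theta q α) σ p).1
      = γ (fderiv 𝕜 (fun q => (σ q).1) p α) - γ (fderiv 𝕜 (fun q => (D.theta q α).1) p v)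
        - α (fderiv 𝕜 (fun q => (σ q).1) p γ)
        + form 𝕜 V (expTail 𝕜 1 (G.adL (D.sDouble p)) (D.sDouble α)) (fderiv 𝕜 X p γ) := by
  have hU : D.U ∈ nhds p := isOpen_U.mem_nhds hp
  have hl : HasFDerivAt D.lcan (fderiv 𝕜 D.lcan p) p :=
    ((contDiffOn_lcan.contDiffAt hU).differentiableAt (by simp)).hasFDerivAt
  have hz := hσ.fst.hasFDerivAt
  have hξ := hσ.snd.hasFDerivAt
  set dz := fderiv 𝕜 (fun q => (σ q).1) p with hdz
  set dξ := fderiv 𝕜 (fun q => (σ q).2) p with hdξ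
  have hXd : fderiv 𝕜 X p γ = ((dz γ : V) + (fderiv 𝕜 D.lcan p γ (σ p).2 + D.lcan p (dξ γ)),
      dξ γ) := by
    have h1 : HasFDerivAt (fun q => (((σ q).1 : V) + D.lcan q (σ q).2, (σ q).2)) _ p :=
      ((D.l.subtypeL.hasFDerivAt.comp p hz).add (hl.clm_apply hξ)).prodMk hξ
    have h2 : X =ᶠ[nhds p] fun q => (((σ q).1 : V) + D.lcan q (σ q).2, (σ q).2) :=
      Filter.eventuallyEq_of_mem hU hX
    rw [h2.fderiv_eq, h1.fderiv]
    simp [add_comm]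
  -- Differentiate the constant anchor of σ in the direction γ and evaluate at the 𝔩-entry of θα.
  -- This trades the derivative of the 𝔤*-entry of σ for brackets in 𝔩.
  have hanchor : dξ γ (D.theta p α).1 = γ (D.subLQB.bracket (σ p).1 (D.theta p α).1)
      + p (D.subLQB.bracket (dz γ) (D.theta p α).1) := by
    set x := (D.theta p α).1
    have h1 : HasFDerivAt (fun q => D.restr (σ q).2 x - q (D.subLQB.bracket (σ q).1 x)) _ p :=
      ((D.restr.hasFDerivAt.comp p hξ).clm_apply (hasFDerivAt_const x p)).sub
        ((hasFDerivAt_id p).clm_apply ((D.subLQB.bracket.flip x).hasFDerivAt.comp p hz))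
    have h2 : (fun q => D.restr (σ q).2 x - q (D.subLQB.bracket (σ q).1 x))
        =ᶠ[nhds p] fun _ => v x :=
      Filter.eventuallyEq_of_mem hU fun q hq => congrArg (fun β : StrongDual 𝕜 D.l => β x) (hv q hq)
    have h3 := congrArg (fun L => L γ) (h1.unique ((hasFDerivAt_const (v x) p).congr_of_eventuallyEq
      h2))
    simp [restr_apply] at h3
    linear_combination h3
  -- The anchor relation of θα, evaluated at d_γ of the 𝔩-entry of σ, absorbs the last unmatched
  -- terms.
  have hα := congrArg (fun β : StrongDual 𝕜 D.l => β (dz γ)) (anchor_theta hD p α)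
  simp only [anchor, adStar, sub_apply, restr_apply, ContinuousLinearMap.comp_apply] at hα
  have hskew : ∀ x y : D.l, D.subLQB.bracket x y = -D.subLQB.bracket y x := fun x y =>
    Subtype.ext (by
      rw [Submodule.coe_neg, coe_subLQB_bracket, coe_subLQB_bracket, hG.bracket_skew])
  have hd : γ (D.diffPairing D.lcan p (D.theta p α).2 (σ p).2)
      = (D.theta p α).2 (fderiv 𝕜 D.lcan p γ (σ p).2) := by
    rw [diffPairing, apply_ofBidual]; rfl
  have hb : (D.bracketN D.lcan (fun q => D.theta q α) σ p).1
      = dz α - fderiv 𝕜 (fun q => (D.theta q α).1) p v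
        - D.subLQB.bracket (D.theta p α).1 (σ p).1
        + D.diffPairing D.lcan p (D.theta p α).2 (σ p).2 := by
    rw [← hv p hp]
    change dz (D.anchor p (D.theta p α)) - _ - _ + _ = _
    rw [anchor_theta hD p α]
  rw [hb, map_add, map_sub, map_sub, hd, hXd, ← twist_theta hD hp, form_apply]
  simp only [map_add]
  rw [hanchor, lcan_skew hG hD hp, hskew (σ p).1, hskew (dz γ), map_neg, map_neg]
  linear_combination (-1 : 𝕜) * hα

omit hG hD [CompleteSpace V] in
-- Twisting by l absorbs the terms ad*_{lξ} in the bracket of 𝔡. The cocycle term has the right sign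
-- by skewness of ϖ; nothing is required of l.
theorem bracketN_snd (hG : G.IsLieQuasiBialgebra)
    (l : StrongDual 𝕜 D.l → StrongDual 𝕜 V →L[𝕜] V)
    (σ τ : StrongDual 𝕜 D.l → D.l × StrongDual 𝕜 V) (p : StrongDual 𝕜 D.l) :
    (D.bracketN l σ τ p).2 = fderiv 𝕜 (fun q => (τ q).2) p (D.anchor p (σ p))
      - fderiv 𝕜 (fun q => (σ q).2) p (D.anchor p (τ p))
      - (G.adL (((σ p).1 : V) + l p (σ p).2, (σ p).2)
          (((τ p).1 : V) + l p (τ p).2, (τ p).2)).2 := by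
  ext x
  have h := hG.cocycle_skew x (σ p).2 (τ p).2
  simp only [bracketN, adL_apply_apply, doubleBracket, adStar, cocycleForm, add_apply, sub_apply,
    ContinuousLinearMap.comp_apply, ContinuousLinearMap.flip_apply, map_add]
  linear_combination h

end ReductiveDecomposition

theorem LQBData.IsLieQuasiBialgebra.adL_skew {𝕜 : Type*} [RCLike 𝕜] {V : Type*}
    [NormedAddCommGroup V] [NormedSpace 𝕜 V] [FiniteDimensional 𝕜 V] {G : LQBData 𝕜 V}
    (hG : G.IsLieQuasiBialgebra) (X Y : V × StrongDual 𝕜 V) : G.adL X Y = -G.adL Y X :=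
  apply_apply_eq_neg_of_self hG.adL_self X Y

namespace ReductiveDecomposition

open LQBData

variable {𝕜 : Type*} [RCLike 𝕜] {V : Type*} [NormedAddCommGroup V] [NormedSpace 𝕜 V]
  [FiniteDimensional 𝕜 V] {G : LQBData 𝕜 V} {D : ReductiveDecomposition G}

/-! ### The Leibniz rule -/

theorem fderiv_clm_apply_fst_snd {P F E₁ E₂ : Type*} [NormedAddCommGroup P] [NormedSpace 𝕜 P]
    [NormedAddCommGroup F] [NormedSpace 𝕜 F] [NormedAddCommGroup E₁] [NormedSpace 𝕜 E₁]
    [NormedAddCommGroup E₂] [NormedSpace 𝕜 E₂] {f : P → F →L[𝕜] E₁ × E₂} {a : P → F} {p : P}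
    (hf : DifferentiableAt 𝕜 f p) (ha : DifferentiableAt 𝕜 a p) (w : P) :
    fderiv 𝕜 (fun q => (f q (a q)).1) p w
        = fderiv 𝕜 (fun q => (f q (a p)).1) p w + (f p (fderiv 𝕜 a p w)).1 ∧
      fderiv 𝕜 (fun q => (f q (a q)).2) p w
        = fderiv 𝕜 (fun q => (f q (a p)).2) p w + (f p (fderiv 𝕜 a p w)).2 := by
  have h1 := hf.hasFDerivAt.clm_apply ha.hasFDerivAt
  have h2 := hf.hasFDerivAt.clm_apply (hasFDerivAt_const (a p) p)
  have e1 : fderiv 𝕜 (fun q => (f q (a q)).1) p = _ := h1.fst.fderiv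
  have e2 : fderiv 𝕜 (fun q => (f q (a p)).1) p = _ := h2.fst.fderiv
  have e3 : fderiv 𝕜 (fun q => (f q (a q)).2) p = _ := h1.snd.fderiv
  have e4 : fderiv 𝕜 (fun q => (f q (a p)).2) p = _ := h2.snd.fderiv
  rw [e1, e2, e3, e4]
  constructor <;> simp [add_comm]

/-- This reduces the main identities to sections with constant coefficients, frozen at their values
at p. -/
theorem bracketN_leibniz {F₁ F₂ : Type*} [NormedAddCommGroup F₁] [NormedSpace 𝕜 F₁]
    [NormedAddCommGroup F₂] [NormedSpace 𝕜 F₂] (l : StrongDual 𝕜 D.l → StrongDual 𝕜 V →L[𝕜] V)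
    {f : StrongDual 𝕜 D.l → F₁ →L[𝕜] D.l × StrongDual 𝕜 V}
    {g : StrongDual 𝕜 D.l → F₂ →L[𝕜] D.l × StrongDual 𝕜 V}
    {a : StrongDual 𝕜 D.l → F₁} {b : StrongDual 𝕜 D.l → F₂} {p : StrongDual 𝕜 D.l}
    (hf : DifferentiableAt 𝕜 f p) (hg : DifferentiableAt 𝕜 g p) (ha : DifferentiableAt 𝕜 a p)
    (hb : DifferentiableAt 𝕜 b p) :
    D.bracketN l (fun q => f q (a q)) (fun q => g q (b q)) p
      = D.bracketN l (fun q => f q (a p)) (fun q => g q (b p)) p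
        + g p (fderiv 𝕜 b p (D.anchor p (f p (a p))))
        - f p (fderiv 𝕜 a p (D.anchor p (g p (b p)))) := by
  have h1 := fun w => fderiv_clm_apply_fst_snd hf ha w
  have h2 := fun w => fderiv_clm_apply_fst_snd hg hb w
  refine Prod.ext ?_ ?_
  · simp only [bracketN, Prod.fst_add, Prod.fst_sub, (h1 _).1, (h2 _).1]
    abel
  · simp only [bracketN, Prod.snd_add, Prod.snd_sub, (h1 _).2, (h2 _).2]
    abel

theorem eq_zero_of_forall_dual_apply_eq_zero {z : D.l}
    (h : ∀ γ : StrongDual 𝕜 D.l, γ z = 0) : z = 0 :=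
  (Module.forall_dual_apply_eq_zero_iff 𝕜 z).1 fun γ => h (LinearMap.toContinuousLinearMap γ)

theorem form_coe_sDouble (z : D.l) (γ : StrongDual 𝕜 D.l) :
    form 𝕜 V ((z : V), 0) (D.sDouble γ) = γ z := by
  rw [form_apply, sDouble_apply, s_apply_coe]; simp

variable [CompleteSpace V] (hG : G.IsLieQuasiBialgebra) (hD : D.IsCanonicallyCompatible)

include hD in
theorem apply_fderiv_theta_fst (p v α γ : StrongDual 𝕜 D.l) :
    γ (fderiv 𝕜 (fun q => (D.theta q α).1) p v)
      = form 𝕜 V (fderiv 𝕜 (fun q => sinhSubDivSq (G.adL (D.sDouble q))) p v (D.sDouble α))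
          (D.sDouble γ) := by
  have h1 : DifferentiableAt 𝕜 (fun q => sinhSubDivSq (G.adL (D.sDouble q))) p :=
    (contDiff_sinhSubDivSq.comp contDiff_adL_sDouble).differentiable (by simp) p
  have h2 : DifferentiableAt 𝕜 (fun q => D.theta q α) p :=
    (contDiff_theta.differentiable (by simp) p).clm_apply (differentiableAt_const _)
  rw [← form_coe_sDouble, ← fderiv_apply_const h1]
  simp_rw [sinhSubDivSq_sDouble hD]
  have h3 : HasFDerivAt (fun q => (((D.theta q α).1 : V), (0 : StrongDual 𝕜 V))) _ p :=
    (D.l.subtypeL.hasFDerivAt.comp p h2.fst.hasFDerivAt).prodMk (hasFDerivAt_const _ p)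
  rw [h3.fderiv]
  rfl

include hD in
theorem fderiv_theta_snd {p : StrongDual 𝕜 D.l} (hp : p ∈ D.U) (v α : StrongDual 𝕜 D.l) :
    fderiv 𝕜 (fun q => (D.theta q α).2) p v
      = (fderiv 𝕜 (fun q => expPrim 1 (1 : 𝕜) (G.adL (D.sDouble q))) p v (D.sDouble α)).2 := by
  have h1 := (differentiable_expPrim_ad (ad := G.adL) D.sDouble 1 (1 : 𝕜) p).hasFDerivAt.clm_apply
    (hasFDerivAt_const (D.sDouble α) p)
  have h2 : (fun q => (D.theta q α).2)
      =ᶠ[nhds p] fun q => (expPrim 1 (1 : 𝕜) (G.adL (D.sDouble q)) (D.sDouble α)).2 :=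
    Filter.eventuallyEq_of_mem (isOpen_U.mem_nhds hp) fun q hq => by
      rw [expPrim_one_one, ← twist_theta hD hq]
  have h3 : fderiv 𝕜 (fun q => (expPrim 1 (1 : 𝕜) (G.adL (D.sDouble q)) (D.sDouble α)).2) p = _ :=
    h1.snd.fderiv
  rw [h2.fderiv_eq, h3]
  simp

include hG hD

/-! ### Flatness of `θ` -/

omit hD in
theorem form_fderiv_sinhSubDivSq_skew (p v α β : StrongDual 𝕜 D.l) :
    form 𝕜 V (fderiv 𝕜 (fun q => sinhSubDivSq (G.adL (D.sDouble q))) p v (D.sDouble α))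
        (D.sDouble β)
      = -form 𝕜 V (fderiv 𝕜 (fun q => sinhSubDivSq (G.adL (D.sDouble q))) p v (D.sDouble β))
        (D.sDouble α) := by
  have hdT : DifferentiableAt 𝕜 (fun q => sinhSubDivSq (G.adL (D.sDouble q))) p :=
    (contDiff_sinhSubDivSq.comp contDiff_adL_sDouble).differentiable (by simp) p
  exact fderiv_skew_adjoint hdT hdT (fun q => by
    rw [sinhSubDivSq_adjoint (hG.form_adL _), form_symm]) v

set_option maxHeartbeats 800000 in
-- By skewness, the three derivatives of the 𝔩-entries of θ form the cyclic sum, equal to half the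
-- Cartan 3-form at (α, β, γ). The term B(Eα, d_γ Eβ) is half the 3-form at (β, α, γ), which is its
-- opposite.
theorem bracketN_theta_theta_fst {p : StrongDual 𝕜 D.l} (hp : p ∈ D.U) (α β : StrongDual 𝕜 D.l) :
    (D.bracketN D.lcan (fun q => D.theta q α) (fun q => D.theta q β) p).1 = 0 := by
  refine eq_zero_of_forall_dual_apply_eq_zero fun γ => ?_
  have hσ : DifferentiableAt 𝕜 (fun q => D.theta q β) p :=
    (contDiff_theta.differentiable (by simp) p).clm_apply (differentiableAt_const _)
  have hdE : DifferentiableAt 𝕜 (fun q => expTail 𝕜 1 (G.adL (D.sDouble q))) p :=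
    ((contDiff_expTail 1).comp contDiff_adL_sDouble).differentiable (by simp) p
  have hc := cyclic_fderiv_sinhSubDivSq (ad := G.adL) (B := form 𝕜 V) D.sDouble hG.adL_self
    hG.adL_jacobi form_symm hG.form_adL p α β γ
  have hi := form_fderiv_expTail_one (ad := G.adL) (B := form 𝕜 V) D.sDouble hG.adL_self
    hG.adL_jacobi form_symm hG.form_adL (form_expTail_sDouble hG hD) p β α γ
  have h1 := form_fderiv_sinhSubDivSq_skew hG p β γ α
  have h2 := hG.adL_skew (expTail 𝕜 1 (G.adL (D.sDouble p)) (D.sDouble α))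
    (expTail 𝕜 1 (G.adL (D.sDouble p)) (D.sDouble β))
  rw [h2, map_neg, neg_apply] at hc
  rw [bracketN_theta_fst hG hD hp hσ (fun q _ => anchor_theta hD q β)
    (X := fun q => expTail 𝕜 1 (G.adL (D.sDouble q)) (D.sDouble β))
    (fun q hq => (twist_theta hD hq β).symm), apply_fderiv_theta_fst hD,
    apply_fderiv_theta_fst hD, apply_fderiv_theta_fst hD, fderiv_apply_const hdE,
    (form_symm _ _).trans hi,
    form_fderiv_sinhSubDivSq_skew hG p γ β α]
  linear_combination hc - h1

theorem bracketN_theta_theta {p : StrongDual 𝕜 D.l} (hp : p ∈ D.U) (α β : StrongDual 𝕜 D.l) :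
    D.bracketN D.lcan (fun q => D.theta q α) (fun q => D.theta q β) p = 0 := by
  refine Prod.ext (bracketN_theta_theta_fst hG hD hp α β) ?_
  rw [bracketN_snd hG, anchor_theta hD, anchor_theta hD, fderiv_theta_snd hD hp,
    fderiv_theta_snd hD hp, twist_theta hD hp, twist_theta hD hp, ← Prod.snd_sub,
    maurerCartan_expPrim_one D.sDouble hG.adL_self hG.adL_jacobi, expPrim_one_one, sub_self]
  rfl

/-! ### Covariant constancy of `ψ` -/

theorem anchor_psi {p : StrongDual 𝕜 D.l} (hp : p ∈ D.U) {X : V × StrongDual 𝕜 V}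
    (hX : X ∈ D.gStar 0) : D.anchor p (D.psi p X) = 0 := by
  obtain ⟨z, hz, hξ⟩ := mem_gStar_zero.1 hX
  have h := (psi_spec hG hD hp z hξ).1
  rw [hz] at h
  exact sub_eq_zero.2 h

/-- Since φ_p = e^{-A} τ, solving φ_p ψX = -X for τψX gives -e^A X. -/
theorem twist_psi {p : StrongDual 𝕜 D.l} (hp : p ∈ D.U) {X : V × StrongDual 𝕜 V}
    (hX : X ∈ D.gStar 0) : -expPrim 0 (1 : 𝕜) (G.adL (D.sDouble p)) X
      = (((D.psi p X).1 : V) + D.lcan p (D.psi p X).2, (D.psi p X).2) := by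
  obtain ⟨z, hz, hξ⟩ := mem_gStar_zero.1 hX
  have h := (psi_spec hG hD hp z hξ).2.1
  rw [hz, phi_apply] at h
  change _ = -X at h
  rw [← map_neg, ← h, expPrim_zero_one_apply_neg_one, incl_apply]

omit hG hD in
theorem differentiableAt_psi {p : StrongDual 𝕜 D.l} (hp : p ∈ D.U) (X : V × StrongDual 𝕜 V) :
    DifferentiableAt 𝕜 (fun q => D.psi q X) p :=
  ((contDiffOn_psi.contDiffAt (isOpen_U.mem_nhds hp)).differentiableAt (by simp)).clm_apply
    (differentiableAt_const _)

omit hD in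
theorem fderiv_neg_expPrim_zero (p v : StrongDual 𝕜 D.l) (X : V × StrongDual 𝕜 V) :
    fderiv 𝕜 (fun q => -expPrim 0 (1 : 𝕜) (G.adL (D.sDouble q)) X) p v
      = -G.adL (expTail 𝕜 1 (G.adL (D.sDouble p)) (D.sDouble v))
        (expPrim 0 (1 : 𝕜) (G.adL (D.sDouble p)) X) := by
  rw [fderiv_fun_neg, neg_apply,
    fderiv_apply_const (differentiable_expPrim_ad (ad := G.adL) D.sDouble 0 (1 : 𝕜) p),
    fderiv_expPrim_zero_ad D.sDouble hG.adL_jacobi, expPrim_one_one]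
  rfl

theorem fderiv_psi_snd {p : StrongDual 𝕜 D.l} (hp : p ∈ D.U) (v : StrongDual 𝕜 D.l)
    {X : V × StrongDual 𝕜 V} (hX : X ∈ D.gStar 0) :
    fderiv 𝕜 (fun q => (D.psi q X).2) p v
      = (fderiv 𝕜 (fun q => -expPrim 0 (1 : 𝕜) (G.adL (D.sDouble q)) X) p v).2 := by
  have hd := differentiable_expPrim_ad (ad := G.adL) D.sDouble 0 (1 : 𝕜) p
  have h1 : DifferentiableAt 𝕜 (fun q => -expPrim 0 (1 : 𝕜) (G.adL (D.sDouble q)) X) p :=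
    (hd.clm_apply (differentiableAt_const X)).neg
  have h2 : fderiv 𝕜 (fun q => (-expPrim 0 (1 : 𝕜) (G.adL (D.sDouble q)) X).2) p = _ :=
    h1.hasFDerivAt.snd.fderiv
  have h3 : (fun q => (D.psi q X).2)
      =ᶠ[nhds p] fun q => (-expPrim 0 (1 : 𝕜) (G.adL (D.sDouble q)) X).2 :=
    Filter.eventuallyEq_of_mem (isOpen_U.mem_nhds hp) fun q hq =>
      (congrArg Prod.snd (twist_psi hG hD hq hX)).symm
  rw [h3.fderiv_eq, h2]
  rfl

theorem apply_fderiv_psi_fst {p : StrongDual 𝕜 D.l} (hp : p ∈ D.U) (v γ : StrongDual 𝕜 D.l)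
    (z : D.l) {ξ : StrongDual 𝕜 V} (hξ : D.restr ξ = 0) :
    γ (fderiv 𝕜 (fun q => (D.psi q ((z : V), ξ)).1) p v)
      = -form 𝕜 V (fderiv 𝕜 (fun q => sinhDiv (G.adL (D.sDouble q))) p v ((z : V), 0))
        (D.sDouble γ) := by
  have hdS : DifferentiableAt 𝕜 (fun q => sinhDiv (G.adL (D.sDouble q))) p :=
    (contDiff_sinhDiv.comp contDiff_adL_sDouble).differentiable (by simp) p
  have h1 : (fun q => (((D.psi q ((z : V), ξ)).1 : V), (0 : StrongDual 𝕜 V)))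
      =ᶠ[nhds p] -fun q => sinhDiv (G.adL (D.sDouble q)) ((z : V), (0 : StrongDual 𝕜 V)) :=
    Filter.eventuallyEq_of_mem (isOpen_U.mem_nhds hp) fun q hq => by
      rw [(psi_spec hG hD hq z hξ).2.2, Pi.neg_apply, sinhDiv_coe hD]
      exact Prod.ext rfl neg_zero.symm
  have h2 : HasFDerivAt (fun q => (((D.psi q ((z : V), ξ)).1 : V), (0 : StrongDual 𝕜 V))) _ p :=
    (D.l.subtypeL.hasFDerivAt.comp p (differentiableAt_psi hp _).fst.hasFDerivAt).prodMk
      (hasFDerivAt_const _ p)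
  have h3 := h2.fderiv
  rw [h1.fderiv_eq, fderiv_neg] at h3
  have h4 : (((fderiv 𝕜 (fun q => (D.psi q ((z : V), ξ)).1) p v : D.l) : V),
      (0 : StrongDual 𝕜 V))
      = -fderiv 𝕜 (fun q => sinhDiv (G.adL (D.sDouble q)) ((z : V), (0 : StrongDual 𝕜 V))) p v :=
    (congrArg (fun L => L v) h3).symm
  rw [← form_coe_sDouble, ← fderiv_apply_const hdS]
  refine (congrArg (fun Y => form 𝕜 V Y (D.sDouble γ)) h4).trans ?_
  rw [map_neg, neg_apply]

/-- At time -1 the primitive is -(sinh A / A - (cosh A - 1)/A). Applied to sα, its even part lies in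
𝔤* and sees only z; its odd part lies in 𝔩 and pairs to zero with ξ ∈ 𝔩^⊥. -/
theorem form_expPrim_neg_one (p α : StrongDual 𝕜 D.l) (z : D.l) {ξ : StrongDual 𝕜 V}
    (hξ : D.restr ξ = 0) :
    form 𝕜 V (expPrim 1 (-1 : 𝕜) (G.adL (D.sDouble p)) (D.sDouble α)) ((z : V), ξ)
      = -form 𝕜 V (sinhDiv (G.adL (D.sDouble p)) ((z : V), 0)) (D.sDouble α) := by
  rw [sinhDiv_adjoint (hG.form_adL _), expPrim_one_neg_one, ← sinhDiv_sub_coshSubOneDiv,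
    neg_apply, sub_apply, sinhDiv_sDouble_eq_theta hD, coshSubOneDiv_sDouble hD, form_apply,
    form_apply]
  have h := fun x : D.l => (D.restr_eq_zero_iff _).1 hξ x x.2
  simp [h]

theorem form_fderiv_expPrim_neg_one (p v α : StrongDual 𝕜 D.l) (z : D.l) {ξ : StrongDual 𝕜 V}
    (hξ : D.restr ξ = 0) :
    form 𝕜 V (fderiv 𝕜 (fun q => expPrim 1 (-1 : 𝕜) (G.adL (D.sDouble q))) p v (D.sDouble α))
        ((z : V), ξ)
      = -form 𝕜 V (fderiv 𝕜 (fun q => sinhDiv (G.adL (D.sDouble q))) p v ((z : V), 0))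
        (D.sDouble α) :=
  fderiv_skew_adjoint (differentiable_expPrim_ad (ad := G.adL) D.sDouble 1 (-1 : 𝕜) p)
    ((contDiff_sinhDiv.comp contDiff_adL_sDouble).differentiable (by simp) p)
    (fun q => form_expPrim_neg_one hG hD q α z hξ) v

/-- By invariance, the term with the derivative of -e^A X is B([Eγ, Eα], e^A X). Transported by
e^{-A}, it is the Maurer–Cartan expression at time -1 paired with X, that is, a difference of two
derivatives of sinh A / A. These cancel the derivatives of the 𝔩-entry of ψ; the anchor of ψ being
zero, no derivative of θ enters. -/
theorem bracketN_theta_psi_fst {p : StrongDual 𝕜 D.l} (hp : p ∈ D.U) (α : StrongDual 𝕜 D.l)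
    (z : D.l) {ξ : StrongDual 𝕜 V} (hξ : D.restr ξ = 0) :
    (D.bracketN D.lcan (fun q => D.theta q α) (fun q => D.psi q ((z : V), ξ)) p).1 = 0 := by
  have hX : ((z : V), ξ) ∈ D.gStar 0 := mem_gStar_zero.2 ⟨z, rfl, hξ⟩
  refine eq_zero_of_forall_dual_apply_eq_zero fun γ => ?_
  have h1 := hG.form_adL (expTail 𝕜 1 (G.adL (D.sDouble p)) (D.sDouble γ))
    (expTail 𝕜 1 (G.adL (D.sDouble p)) (D.sDouble α))
    (expPrim 0 (1 : 𝕜) (G.adL (D.sDouble p)) ((z : V), ξ))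
  have h2 := form_bracket_expPrim_one (B := form 𝕜 V) hG.adL_jacobi hG.form_adL (1 : 𝕜)
    (D.sDouble p) (D.sDouble γ) (D.sDouble α) ((z : V), ξ)
  rw [← maurerCartan_expPrim_one D.sDouble hG.adL_self hG.adL_jacobi (-1), map_sub, sub_apply,
    form_fderiv_expPrim_neg_one hG hD _ _ _ z hξ, form_fderiv_expPrim_neg_one hG hD _ _ _ z hξ,
    expPrim_one_one] at h2
  rw [bracketN_theta_fst hG hD hp (differentiableAt_psi hp _)
    (fun q hq => anchor_psi hG hD hq hX) (fun q hq => twist_psi hG hD hq hX), map_zero, map_zero,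
    apply_fderiv_psi_fst hG hD hp _ _ z hξ, apply_fderiv_psi_fst hG hD hp _ _ z hξ,
    fderiv_neg_expPrim_zero hG, map_neg]
  linear_combination h2 - h1

theorem bracketN_theta_psi {p : StrongDual 𝕜 D.l} (hp : p ∈ D.U) (α : StrongDual 𝕜 D.l)
    {X : V × StrongDual 𝕜 V} (hX : X ∈ D.gStar 0) :
    D.bracketN D.lcan (fun q => D.theta q α) (fun q => D.psi q X) p = 0 := by
  refine Prod.ext ?_ ?_
  · obtain ⟨x, ξ⟩ := X
    obtain ⟨z, rfl, hξ⟩ := mem_gStar_zero.1 hX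
    exact bracketN_theta_psi_fst hG hD hp α z hξ
  · rw [bracketN_snd hG, anchor_theta hD, anchor_psi hG hD hp hX, map_zero, twist_theta hD hp,
      ← twist_psi hG hD hp hX, fderiv_psi_snd hG hD hp _ hX, fderiv_neg_expPrim_zero hG, map_neg,
      sub_zero, sub_self]
    rfl

end ReductiveDecomposition

end

theorem mainTheorem9 {𝕜 : Type*} [RCLike 𝕜] {V : Type*} [NormedAddCommGroup V] [NormedSpace 𝕜 V]
    [FiniteDimensional 𝕜 V] (G : LQBData 𝕜 V) (hG : G.IsLieQuasiBialgebra)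
    (D : ReductiveDecomposition G) (hD : D.IsCanonicallyCompatible) :
    -- the differentials below make sense: `U` is open and the canonical `ℓ`-matrix is smooth on it
    IsOpen D.U ∧ ContDiffOn 𝕜 ∞ D.lcan D.U ∧
    -- `θ` is well defined and a flat connection
    (∀ p ∈ D.U, ∀ α,
      sinhSubDivSq (G.adDouble (D.sDouble p)) (D.sDouble α) = (((D.theta p α).1 : V), 0) ∧
      sinhDiv (G.adDouble (D.sDouble p)) (D.sDouble α) = (0, (D.theta p α).2)) ∧
    D.IsFlatConnection D.U D.lcan D.theta ∧
    -- `ψ` is well defined: `φ_p` is invertible and maps `𝔤^⋆_p` bijectively onto `𝔤^⋆_0`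
    (∀ p ∈ D.U, IsUnit (D.phi p) ∧ Set.BijOn (D.phi p) (D.gStar p) (D.gStar 0)) ∧
    -- compatibility of `θ` and `ψ`
    ∀ (α : StrongDual 𝕜 D.l → StrongDual 𝕜 D.l) (X : StrongDual 𝕜 D.l → V × StrongDual 𝕜 V),
      ContDiffOn 𝕜 ∞ α D.U → ContDiffOn 𝕜 ∞ X D.U → (∀ p ∈ D.U, X p ∈ D.gStar 0) →
        ContDiffOn 𝕜 ∞ (fun q => D.psi q (X q)) D.U ∧
        ∀ p ∈ D.U, D.bracketN D.lcan (fun q => D.theta q (α q)) (fun q => D.psi q (X q)) p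
          = D.psi p (fderiv 𝕜 X p (α p)) := by
  have := FiniteDimensional.complete 𝕜 V
  have hd : ∀ {F : Type _} [NormedAddCommGroup F] [NormedSpace 𝕜 F] {f : StrongDual 𝕜 D.l → F},
      ContDiffOn 𝕜 ∞ f D.U → ∀ p ∈ D.U, DifferentiableAt 𝕜 f p := fun hf p hp =>
    (hf.contDiffAt (ReductiveDecomposition.isOpen_U.mem_nhds hp)).differentiableAt (by simp)
  have hθ := fun p => (D.contDiff_theta).differentiable (by simp) p
  refine ⟨D.isOpen_U, D.contDiffOn_lcan, fun p _ α =>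
    ⟨D.sinhSubDivSq_sDouble hD p α, D.sinhDiv_sDouble_eq_theta hD p α⟩,
    ⟨D.contDiff_theta.contDiffOn, fun p _ α => D.anchor_theta hD p α, ?_⟩,
    fun p hp => ⟨D.isUnit_phi p, D.bijOn_phi hG hD hp⟩, fun α X hα hX hX0 =>
      ⟨D.contDiffOn_psi.clm_apply hX, ?_⟩⟩
  · intro α β hα hβ p hp
    -- The constant-coefficient bracket vanishes and the anchor inverts θ; what is left is θ(dβ(α) -
    -- dα(β)).
    rw [ReductiveDecomposition.bracketN_leibniz _ (hθ p) (hθ p) (hd hα p hp) (hd hβ p hp),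
      ReductiveDecomposition.bracketN_theta_theta hG hD hp, ReductiveDecomposition.anchor_theta hD,
      ReductiveDecomposition.anchor_theta hD, zero_add, ← map_sub]
    rfl
  · intro p hp
    -- As ψX has zero anchor, α is not differentiated, and only the derivative of X along α
    -- survives.
    rw [ReductiveDecomposition.bracketN_leibniz _ (hθ p)
      (hd ReductiveDecomposition.contDiffOn_psi p hp) (hd hα p hp) (hd hX p hp),
      ReductiveDecomposition.bracketN_theta_psi hG hD hp _ (hX0 p hp),
      ReductiveDecomposition.anchor_theta hD,
      ReductiveDecomposition.anchor_psi hG hD hp (hX0 p hp)]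
    simp
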